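/- **Theorem (Decomposition theorem 1).** *Conventions.* A polytope is the convex hull of a finite set of points in some $\mathbb{R}^e$; a $d$-polytope ($d\ge 0$) is a nonempty polytope whose affine hull has dimension $d$. Let $\mathcal F(P)$ be the set of nonempty faces of $P$, including $P$ itself. A triangulation of $P$ is a finite collection $\mathcal C$ of simplices (including $\emptyset$) that contains every face of each of its members, in which the intersection of any two members is a face of both, and whose union is $P$. For $F\in\mathcal F(P)$ put $\mathcal C_F=\{Q\in\mathcal C : Q\subseteq F\}$. A triangulation $\mathcal C$ of $P$ is *pointed* with apexes $V(P)=(\mathbf v_F)_{F\in\mathcal F(P)}$ if 1. for every $F\in\mathcal F(P)$, $\mathcal C_F$ is a triangulation of $F$, $\mathbf v_F$ is a vertex of $F$, and $\mathbf v_F$ lies in every simplex of $\mathcal C_F$ of dimension $\dim F$; 2. for all $F_1,F_2\in\mathcal F(P)$, if $\mathbf v_{F_1},\mathbf v_{F_2}\in F_1\cap F_2$ then $\mathbf v_{F_1}=\mathbf v_{F_2}$; 3. for every $F\in\mathcal F(P)$ and every vertex $\mathbf w\neq\mathbf v_F$ of $F$, the segment $\mathrm{conv}\{\mathbf v_F,\mathbf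 w\}$ belongs to $\mathcal C_F$. The *$V(P)$-polytope numbers* $P(n)$ and *interior polytope numbers* $P(n)^\sharp$ ($n\ge 0$) are defined, for $P$ and likewise for each of its nonempty faces, by double induction on the dimension and $n$. In dimension $0$: $P(0)=P(0)^\sharp=0$ and $P(n)=P(n)^\sharp=1$ for $n\ge1$. In dimension $\ge 1$: $P(0)=0$, $P(1)=1$, $P(0)^\sharp=P(1)^\sharp=0$, and for $n\ge2$ $$P(n)=P(n-1)+\sum_{F\in\mathcal F(P),\ \mathbf v_P\notin F}F(n)^\sharp,\qquad P(n)^\sharp=P(n)-\sum_{F\in\mathcal F(P)\setminus\{P\}}F(n)^\sharp .$$ The *$d$-simplex numbers* are $\alpha^d(m)=\binom{m-1+d}{d}$ for integers $m\ge1$ and $\alpha^d(m)=0$ for integers $m\le 0$. *Statement.* Let $P$ be a $d$-polytope with a pointed triangulation with apexes $V(P)$, and let $P(n)$ be its $V(P)$-polytope numbers. Then there are nonnegative integers $a_1,\dots,a_{d-1}$ such that for all integers $n\ge0$ $$P(n)=\alpha^d(n)+\sum_{i=1}^{d-1}a_i\,\alpha^d(n-i)$$ (the sum being empty for $d\le1$).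 -/

import Mathlib

namespace PolytopeNumbers

noncomputable section

variable {E : Type*} [NormedAddCommGroup E] [NormedSpace ℝ E]

/-- A polytope: the convex hull of a finite set of points (the empty polytope is allowed). -/
def IsPolytope (P : Set E) : Prop :=
  ∃ s : Finset E, P = convexHull ℝ (s : Set E)

/-- The dimension of (the affine hull of) a nonempty set. The empty set gets the junk value `0`,
so nonemptiness is required wherever dimensions are used below. -/
def dim (P : Set E) : ℕ := Module.finrank ℝ (vectorSpan ℝ P)

/-- A `d`-polytope: a nonempty polytope whose affine hull has dimension `d`. -/
def IsDPolytope (d : ℕ) (P : Set E) : Prop :=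
  IsPolytope P ∧ P.Nonempty ∧ dim P = d

/-- `F` is a face of `P`: `F` is empty or the set of points of `P` at which some linear form
attains its maximum over `P`. Both `∅` and `P` are faces. -/
def IsFace (P F : Set E) : Prop := IsExposed ℝ P F

/-- The nonempty faces of `P`, including `P` itself. -/
def faces (P : Set E) : Set (Set E) := {F | IsFace P F ∧ F.Nonempty}

/-- The nonempty faces of `P` other than `P`. -/
def properFaces (P : Set E) : Set (Set E) := {F | F ∈ faces P ∧ F ≠ P}

/-- The vertices of `P`: the points `x` such that `{x}` is a face. -/
def vert (P : Set E) : Set E := {x | IsFace P {x}}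

/-- A simplex (possibly empty): the convex hull of an affinely independent finite set. -/
def IsSimplex (Q : Set E) : Prop :=
  ∃ s : Finset E, AffineIndependent ℝ ((↑) : s → E) ∧ Q = convexHull ℝ (s : Set E)

/-- A polytopal complex. -/
structure IsPolytopalComplex (C : Set (Set E)) : Prop where
  finite : C.Finite
  polytope : ∀ Q ∈ C, IsPolytope Q
  empty_mem : ∅ ∈ C
  face_mem : ∀ Q ∈ C, ∀ F, IsFace Q F → F ∈ C
  inter_face : ∀ Q ∈ C, ∀ Q' ∈ C, IsFace Q (Q ∩ Q') ∧ IsFace Q' (Q ∩ Q')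

/-- A triangulation of `P`: a polytopal complex of simplices with underlying set `P`. -/
structure IsTriangulation (P : Set E) (C : Set (Set E)) : Prop where
  complex : IsPolytopalComplex C
  sUnion_eq : ⋃₀ C = P
  simplex : ∀ Q ∈ C, IsSimplex Q

/-- The part of the complex `C` that lies in `F`. -/
def restrict (C : Set (Set E)) (F : Set E) : Set (Set E) := {Q ∈ C | Q ⊆ F}

/-- `C` is a pointed triangulation of `P`; the apex of a nonempty face `F` is `v F`. Only the
values of `v` on nonempty faces of `P` matter. -/
structure IsPointedTriangulation (P : Set E) (v : Set E → E) (C : Set (Set E)) : Prop where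
  triangulation : IsTriangulation P C
  /-- Each face is triangulated by the part of `C` in it. -/
  face_triangulation : ∀ F ∈ faces P, IsTriangulation F (restrict C F)
  /-- The apex of a face is one of its vertices. -/
  apex_mem_vert : ∀ F ∈ faces P, v F ∈ vert F
  /-- The apex of a face lies in every simplex of full dimension of its triangulation. -/
  apex_mem : ∀ F ∈ faces P, ∀ Q ∈ restrict C F, Q.Nonempty → dim Q = dim F → v F ∈ Q
  /-- Apexes are compatible. -/
  apex_eq : ∀ F₁ ∈ faces P, ∀ F₂ ∈ faces P,
    v F₁ ∈ F₁ ∩ F₂ → v F₂ ∈ F₁ ∩ F₂ → v F₁ = v F₂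
  /-- The apex of a face is joined to the other vertices of the face by edges. -/
  edge_mem : ∀ F ∈ faces P, ∀ w ∈ vert F, w ≠ v F → convexHull ℝ {v F, w} ∈ restrict C F

/-- Proper nonempty faces have smaller dimension; the recursion below rests on this. -/
theorem dim_lt_of_mem_properFaces [FiniteDimensional ℝ E] {P F : Set E}
    (h : F ∈ properFaces P) : dim F < dim P := by
  obtain ⟨⟨hF, hne⟩, hFP⟩ := h
  have hsub : F ⊆ P := hF.subset
  obtain ⟨l, hl⟩ := hF hne
  obtain ⟨x, hx⟩ := hne
  obtain ⟨y, hyP, hyF⟩ : ∃ y ∈ P, y ∉ F := by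
    by_contra! hc
    exact hFP (hsub.antisymm hc)
  have hxm : ∀ z ∈ P, l z ≤ l x := by rw [hl] at hx; exact hx.2
  have hconst : ∀ z ∈ F, l z = l x := by
    intro z hz
    refine le_antisymm (hxm z (hsub hz)) ?_
    rw [hl] at hz
    exact hz.2 x (hsub hx)
  have hyx : l y ≠ l x := by
    intro he
    apply hyF
    rw [hl]
    exact ⟨hyP, fun z hz => he ▸ hxm z hz⟩
  have hker : vectorSpan ℝ F ≤ LinearMap.ker l.toLinearMap := by
    rw [vectorSpan_def, Submodule.span_le]
    rintro _ ⟨a, ha, b, hb, rfl⟩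
    simp [hconst a ha, hconst b hb]
  apply Submodule.finrank_lt_finrank_of_lt
  refine lt_of_le_of_ne (vectorSpan_mono ℝ hsub) ?_
  intro he
  have hm : y -ᵥ x ∈ vectorSpan ℝ F := he ▸ vsub_mem_vectorSpan ℝ hyP (hsub hx)
  have := hker hm
  simp [sub_eq_zero] at this
  exact hyx this

mutual

/-- The polytope number `P(n)` with respect to the apexes `v F` of the nonempty faces `F` of `P`.
(A face that misses `v P ∈ P` is automatically proper.) -/
def polytopeNumber [FiniteDimensional ℝ E] (v : Set E → E) (P : Set E) : ℕ → ℤ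
  | 0 => 0
  | 1 => 1
  | n + 2 =>
    if dim P = 0 then 1
    else polytopeNumber v P (n + 1) +
      ∑ᶠ (F : Set E) (_ : F ∈ properFaces P ∩ {F | v P ∉ F}), interiorPolytopeNumber v F (n + 2)
  termination_by n => (dim P, n, 0)
  decreasing_by
    · exact Prod.Lex.right _ (Prod.Lex.left _ _ (by omega))
    · exact Prod.Lex.left _ _ (dim_lt_of_mem_properFaces (by rename_i h; exact h.1))

/-- The interior polytope number `P(n)^♯`. -/
def interiorPolytopeNumber [FiniteDimensional ℝ E] (v : Set E → E) (P : Set E) : ℕ → ℤ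
  | 0 => 0
  | 1 => if dim P = 0 then 1 else 0
  | n + 2 =>
    if dim P = 0 then 1
    else polytopeNumber v P (n + 2) -
      ∑ᶠ (F : Set E) (_ : F ∈ properFaces P), interiorPolytopeNumber v F (n + 2)
  termination_by n => (dim P, n, 1)
  decreasing_by
    · exact Prod.Lex.right _ (Prod.Lex.right _ (by omega))
    · exact Prod.Lex.left _ _ (dim_lt_of_mem_properFaces (by assumption))

end

/-- The `d`-simplex numbers `α^d(m) = C(m - 1 + d, d)` for `m ≥ 1`, and `α^d(m) = 0` for
`m ≤ 0`. -/
def simplexNumber (d : ℕ) (m : ℤ) : ℕ :=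
  if m ≤ 0 then 0 else (m.toNat - 1 + d).choose d

end

end PolytopeNumbers

-- Write n = N + 2 and give a simplex with k ≥ 1 vertices the weight C(N, k - 1), its number of
-- interior points; the empty simplex has weight 0. Let K be the set of vertex sets of the
-- triangulation. The total weight of K is evaluated in two ways.
--
-- On the one hand it is P(n), while P(n)^♯ is the weight of the simplices lying in no proper face
-- (`polytopeNumber_eq`). Each nonempty simplex is inner to exactly one face, and a simplex inner to
-- a face containing v_P has v_P as a vertex (`apex_mem_of_mem_innerPart`). Hence the faces missing
-- v_P account exactly for the simplices missing v_P. As K is a cone with apex v_P, Pascal's rule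
-- turns the defining recursion into an identity between weights.
--
-- On the other hand, fix a generic point q of P. For a full-dimensional simplex s let R(s) be the
-- set of vertices opposite to the facets visible from q. The intervals [R(s), s] partition K
-- (`eq_biUnion_Icc`, `pairwiseDisjoint_Icc`): the interval of Q is found by moving slightly from
-- the barycentre of Q towards q. If |R(s)| = i, Pascal's rule gives the interval the weight C(N + d
-- + 1 - i, d) = α^d(n - i). So a_i counts the s with |R(s)| = i (an h-vector).
--
-- The coefficient of α^d(n) is 1 because ∅ lies in one interval only. No i ≥ d occurs because every
-- vertex of K is a vertex of P (`mem_vert`, `card_visible_add_two_le`).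

namespace PolytopeNumbers

open scoped Classical

noncomputable section

variable {E : Type*} [NormedAddCommGroup E] [NormedSpace ℝ E]

-- Barycentric coordinates.

/-- Barycentric coordinates of `p` with respect to `s` (zero if `p` is not in the affine span). -/
def bary (s : Finset E) (p : E) : E → ℝ :=
  if h : ∃ w : E → ℝ, ∑ x ∈ s, w x = 1 ∧ ∑ x ∈ s, w x • x = p then h.choose else 0

theorem exists_weights_of_mem_affineSpan {s : Finset E} {p : E}
    (hp : p ∈ affineSpan ℝ (s : Set E)) :
    ∃ w : E → ℝ, ∑ x ∈ s, w x = 1 ∧ ∑ x ∈ s, w x • x = p := by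
  have hr : (s : Set E) = Set.range ((↑) : s → E) := by simp
  rw [hr] at hp
  obtain ⟨w, hw, hwp⟩ := eq_affineCombination_of_mem_affineSpan_of_fintype hp
  rw [Finset.affineCombination_eq_linear_combination _ _ _ hw] at hwp
  refine ⟨fun x => if h : x ∈ s then w ⟨x, h⟩ else 0, ?_, ?_⟩
  · rw [← Finset.sum_coe_sort s]
    simpa using hw
  · rw [← Finset.sum_coe_sort s]
    simpa using hwp.symm

theorem sum_smul_mem_affineSpan {s : Finset E} {w : E → ℝ} (hw : ∑ x ∈ s, w x = 1) :
    ∑ x ∈ s, w x • x ∈ affineSpan ℝ (s : Set E) := by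
  have := affineCombination_mem_affineSpan (k := ℝ) (s := s.attach) (w := fun x => w x)
    (p := ((↑) : s → E))
    (by rw [Finset.sum_attach s w]; exact hw)
  rw [Finset.affineCombination_eq_linear_combination _ _ _
    (by rw [Finset.sum_attach s w]; exact hw), Finset.sum_attach s (fun x => w x • x)] at this
  simpa using this

theorem sum_bary {s : Finset E} {p : E} (hp : p ∈ affineSpan ℝ (s : Set E)) :
    ∑ x ∈ s, bary s p x = 1 := by
  have h := exists_weights_of_mem_affineSpan hp
  rw [bary, dif_pos h]
  exact h.choose_spec.1

theorem sum_bary_smul {s : Finset E} {p : E} (hp : p ∈ affineSpan ℝ (s : Set E)) :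
    ∑ x ∈ s, bary s p x • x = p := by
  have h := exists_weights_of_mem_affineSpan hp
  rw [bary, dif_pos h]
  exact h.choose_spec.2

theorem bary_eq {s : Finset E} (hs : AffineIndependent ℝ ((↑) : s → E)) {p : E} {w : E → ℝ}
    (hw : ∑ x ∈ s, w x = 1) (hwp : ∑ x ∈ s, w x • x = p) {x : E} (hx : x ∈ s) :
    bary s p x = w x := by
  have hp : p ∈ affineSpan ℝ (s : Set E) := hwp ▸ sum_smul_mem_affineSpan hw
  exact hs.eq_of_sum_eq_sum_subtype (by rw [sum_bary hp, hw]) (by rw [sum_bary_smul hp, hwp]) x hx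

theorem bary_eq_of_subset {s t : Finset E} (hs : AffineIndependent ℝ ((↑) : s → E)) (hts : t ⊆ s)
    {p : E} {w : E → ℝ} (hw : ∑ x ∈ t, w x = 1) (hwp : ∑ x ∈ t, w x • x = p) {x : E}
    (hx : x ∈ s) : bary s p x = if x ∈ t then w x else 0 := by
  refine bary_eq hs (w := fun x => if x ∈ t then w x else 0) ?_ ?_ hx
  · rw [Finset.sum_ite_mem, Finset.inter_eq_right.2 hts, hw]
  · simp only [ite_smul, zero_smul]
    rw [Finset.sum_ite_mem, Finset.inter_eq_right.2 hts, hwp]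

theorem mem_affineSpan_of_mem_convexHull {s : Set E} {p : E} (hp : p ∈ convexHull ℝ s) :
    p ∈ affineSpan ℝ s := convexHull_subset_affineSpan _ hp

theorem bary_nonneg {s : Finset E} (hs : AffineIndependent ℝ ((↑) : s → E)) {p : E}
    (hp : p ∈ convexHull ℝ (s : Set E)) {x : E} (hx : x ∈ s) : 0 ≤ bary s p x := by
  obtain ⟨w, hw0, hw1, hwp⟩ := Finset.mem_convexHull'.1 hp
  rw [bary_eq hs hw1 hwp hx]
  exact hw0 x hx

theorem mem_convexHull_of_bary_nonneg {s : Finset E} {p : E} (hp : p ∈ affineSpan ℝ (s : Set E))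
    (h : ∀ x ∈ s, 0 ≤ bary s p x) : p ∈ convexHull ℝ (s : Set E) :=
  Finset.mem_convexHull'.2 ⟨_, h, sum_bary hp, sum_bary_smul hp⟩

theorem bary_eq_zero_of_mem_affineSpan {s t : Finset E}
    (hs : AffineIndependent ℝ ((↑) : s → E)) (hts : t ⊆ s) {p : E}
    (hp : p ∈ affineSpan ℝ (t : Set E)) {x : E} (hx : x ∈ s) (hxt : x ∉ t) : bary s p x = 0 := by
  rw [bary_eq_of_subset hs hts (sum_bary hp) (sum_bary_smul hp) hx, if_neg hxt]

theorem mem_affineSpan_of_bary_eq_zero {s t : Finset E} (hts : t ⊆ s) {p : E}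
    (hp : p ∈ affineSpan ℝ (s : Set E)) (h : ∀ x ∈ s, x ∉ t → bary s p x = 0) :
    p ∈ affineSpan ℝ (t : Set E) := by
  have h1 : ∑ x ∈ t, bary s p x = 1 := by
    rw [Finset.sum_subset hts h, sum_bary hp]
  have h2 : ∑ x ∈ t, bary s p x • x = p := by
    rw [Finset.sum_subset hts (fun x hx hxt => by rw [h x hx hxt, zero_smul]), sum_bary_smul hp]
  rw [← h2]
  exact sum_smul_mem_affineSpan h1

theorem bary_add_smul_sub {s : Finset E} (hs : AffineIndependent ℝ ((↑) : s → E)) {p q : E}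
    (hp : p ∈ affineSpan ℝ (s : Set E)) (hq : q ∈ affineSpan ℝ (s : Set E)) (r : ℝ) {x : E}
    (hx : x ∈ s) : bary s (p + r • (q - p)) x = (1 - r) * bary s p x + r * bary s q x := by
  refine bary_eq hs (w := fun x => (1 - r) * bary s p x + r * bary s q x) ?_ ?_ hx
  · rw [Finset.sum_add_distrib, ← Finset.mul_sum, ← Finset.mul_sum, sum_bary hp, sum_bary hq]
    ring
  · simp only [add_smul, mul_smul]
    rw [Finset.sum_add_distrib, ← Finset.smul_sum, ← Finset.smul_sum, sum_bary_smul hp,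
      sum_bary_smul hq]
    module

theorem add_smul_sub_mem_affineSpan {s : AffineSubspace ℝ E} {p q : E} (hp : p ∈ s) (hq : q ∈ s)
    (r : ℝ) : p + r • (q - p) ∈ s := by
  have := AffineMap.lineMap_mem r hp hq
  rwa [AffineMap.lineMap_apply_module', add_comm] at this

-- Avoiding finitely many flats.

/-- A line through a point outside an affine subspace meets it at most once. -/
theorem eq_of_add_smul_sub_mem {s : AffineSubspace ℝ E} {p q : E} {a b : ℝ}
    (ha : p + a • (q - p) ∈ s) (hb : p + b • (q - p) ∈ s) (h : p ∉ s ∨ q ∉ s) : a = b := by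
  by_contra hab
  have hba : b - a ≠ 0 := sub_ne_zero.2 (Ne.symm hab)
  have key : ∀ c : ℝ, p + c • (q - p) ∈ s := by
    intro c
    have := add_smul_sub_mem_affineSpan ha hb ((c - a) / (b - a))
    convert this using 1
    have : c = a + (c - a) / (b - a) * (b - a) := by field_simp; ring
    nth_rewrite 1 [this]
    module
  rcases h with h | h
  · exact h (by simpa using key 0)
  · exact h (by simpa using key 1)

/-- A convex set contained in none of finitely many affine subspaces has a point outside all. -/
theorem exists_mem_forall_notMem {P : Set E} (hP : Convex ℝ P) (hne : P.Nonempty)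
    (A : Finset (AffineSubspace ℝ E)) (hA : ∀ a ∈ A, ¬ P ⊆ a) : ∃ q ∈ P, ∀ a ∈ A, q ∉ a := by
  induction A using Finset.induction_on with
  | empty => exact ⟨hne.some, hne.some_mem, by simp⟩
  | insert a A _ ih =>
    obtain ⟨y, hy, hyA⟩ := ih fun b hb => hA b (Finset.mem_insert_of_mem hb)
    obtain ⟨x, hx, hxa⟩ := Set.not_subset.1 (hA a (Finset.mem_insert_self _ _))
    -- The line from y to x is contained in none of the flats (y avoids those in A, x avoids a), so
    -- it meets each at most once and all but finitely many parameters are good.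
    have hfin : (⋃ b ∈ insert a A, {r : ℝ | y + r • (x - y) ∈ b}).Finite := by
      refine (Finset.finite_toSet _).biUnion fun b hb => Set.Subsingleton.finite ?_
      intro r hr r' hr'
      refine eq_of_add_smul_sub_mem hr hr' ?_
      rcases Finset.mem_insert.1 hb with rfl | hb
      · exact Or.inr hxa
      · exact Or.inl (hyA b hb)
    obtain ⟨r, hr, hr'⟩ := (Set.Icc_infinite (zero_lt_one (α := ℝ))).exists_notMem_finite hfin
    refine ⟨y + r • (x - y), hP.add_smul_sub_mem hy hx hr, fun b hb hmem => hr' ?_⟩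
    exact Set.mem_biUnion hb hmem

-- Simplicial complexes and the partition by visibility from a generic point.

/-- A finite geometric simplicial complex, given by the vertex sets of its simplices (including
the empty simplex), whose underlying set is `P`. -/
structure Triangulates (P : Set E) (K : Finset (Finset E)) : Prop where
  convex : Convex ℝ P
  nonempty : P.Nonempty
  indep : ∀ s ∈ K, AffineIndependent ℝ ((↑) : s → E)
  down_closed : ∀ s ∈ K, ∀ t ⊆ s, t ∈ K
  inter : ∀ s ∈ K, ∀ t ∈ K, ∀ p ∈ convexHull ℝ (s : Set E), p ∈ convexHull ℝ (t : Set E) →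
    p ∈ convexHull ℝ ((s ∩ t : Finset E) : Set E)
  cover : ∀ p ∈ P, ∃ s ∈ K, p ∈ convexHull ℝ (s : Set E)
  subset : ∀ s ∈ K, (s : Set E) ⊆ P

/-- The simplices of `K` that affinely span `P`. -/
def fullSimplices (P : Set E) (K : Finset (Finset E)) : Finset (Finset E) :=
  {s ∈ K | P ⊆ affineSpan ℝ (s : Set E)}

/-- The average of the points of `s`. -/
def average (s : Finset E) : E := ∑ x ∈ s, ((s.card : ℝ)⁻¹) • x

theorem sum_average_weights {α : Type*} {s : Finset α} (hs : s.Nonempty) :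
    ∑ _x ∈ s, ((s.card : ℝ)⁻¹) = 1 := by
  have : (s.card : ℝ) ≠ 0 := by simpa using hs.ne_empty
  simp [this]

theorem average_mem_convexHull {s : Finset E} (hs : s.Nonempty) :
    average s ∈ convexHull ℝ (s : Set E) :=
  Finset.mem_convexHull'.2 ⟨fun _ => (s.card : ℝ)⁻¹, fun _ _ => by positivity,
    sum_average_weights hs, rfl⟩

theorem bary_average {s t : Finset E} (hs : AffineIndependent ℝ ((↑) : s → E)) (hts : t ⊆ s)
    (ht : t.Nonempty) {x : E} (hx : x ∈ s) :
    bary s (average t) x = if x ∈ t then (t.card : ℝ)⁻¹ else 0 :=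
  bary_eq_of_subset hs hts (sum_average_weights ht) rfl hx

namespace Triangulates

variable {P : Set E} {K : Finset (Finset E)}

theorem convexHull_subset (hK : Triangulates P K) {s : Finset E} (hs : s ∈ K) :
    convexHull ℝ (s : Set E) ⊆ P := convexHull_min (hK.subset s hs) hK.convex

/-- A simplex whose relative interior meets another simplex is a face of it. -/
theorem subset_of_bary_pos (hK : Triangulates P K) {s t : Finset E} (hs : s ∈ K) (ht : t ∈ K)
    {p : E} (hps : p ∈ convexHull ℝ (s : Set E)) (hpt : p ∈ convexHull ℝ (t : Set E)) {x : E}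
    (hx : x ∈ s) (h : 0 < bary s p x) : x ∈ t := by
  by_contra hxt
  have := bary_eq_zero_of_mem_affineSpan (hK.indep s hs) Finset.inter_subset_left
    (mem_affineSpan_of_mem_convexHull (hK.inter s hs t ht p hps hpt)) hx
    (fun hm => hxt (Finset.mem_inter.1 hm).2)
  exact h.ne' this

/-- All barycentric coordinates of the average are positive, so it serves as a concrete point of the
relative interior. -/
theorem subset_of_average_mem (hK : Triangulates P K) {s t : Finset E} (hs : s ∈ K) (ht : t ∈ K)
    (hne : s.Nonempty) (h : average s ∈ convexHull ℝ (t : Set E)) : s ⊆ t := fun x hx =>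
  hK.subset_of_bary_pos hs ht (average_mem_convexHull hne) h hx (by
    rw [bary_average (hK.indep s hs) subset_rfl hne hx, if_pos hx]
    have := Finset.card_pos.2 hne
    positivity)

/-- Some simplex contains an initial piece of the segment from `c` to `q`. -/
theorem exists_initial_segment (hK : Triangulates P K) {c q : E} (hc : c ∈ P) (hq : q ∈ P) :
    ∃ s ∈ K, c ∈ convexHull ℝ (s : Set E) ∧
      ∃ r : ℝ, 0 < r ∧ r ≤ 1 ∧ c + r • (q - c) ∈ convexHull ℝ (s : Set E) := by
  have hmem : ∀ k : ℕ, (1 / ((k : ℝ) + 1)) ∈ Set.Icc (0 : ℝ) 1 := fun k =>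
    ⟨by positivity, by rw [div_le_one (by positivity)]; linarith [k.cast_nonneg (α := ℝ)]⟩
  have hex : ∀ k : ℕ, ∃ s ∈ K, c + (1 / ((k : ℝ) + 1)) • (q - c) ∈ convexHull ℝ (s : Set E) :=
    fun k => hK.cover _ (hK.convex.add_smul_sub_mem hc hq (hmem k))
  choose f hfK hf using hex
  -- Pigeonhole: one simplex contains c + (q - c)/(k + 1) for infinitely many k, and being closed it
  -- contains the limit c.
  obtain ⟨s, hs⟩ := Finite.exists_infinite_fiber (fun k => (⟨f k, hfK k⟩ : K))
  have hinf : {k | f k = s}.Infinite := by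
    rw [Set.infinite_coe_iff] at hs
    refine hs.mono ?_
    intro k hk
    simp only [Set.mem_preimage, Set.mem_singleton_iff] at hk
    simp [← hk]
  have hs' : ∀ k, f k = s →
      c + (1 / ((k : ℝ) + 1)) • (q - c) ∈ convexHull ℝ ((s : Finset E) : Set E) :=
    fun k hk => hk ▸ hf k
  refine ⟨s, s.2, ?_, ?_⟩
  · have hclosed : IsClosed (convexHull ℝ ((s : Finset E) : Set E)) :=
      (Finset.finite_toSet _).isClosed_convexHull ℝ
    have hlim : Filter.Tendsto (fun k : ℕ => c + (1 / ((k : ℝ) + 1)) • (q - c)) Filter.atTop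
        (nhds c) := by
      have := (tendsto_one_div_add_atTop_nhds_zero_nat (𝕜 := ℝ)).smul_const (q - c)
      simpa using this.const_add c
    refine hclosed.mem_of_frequently_of_tendsto ?_ hlim
    exact (Nat.frequently_atTop_iff_infinite.2 hinf).mono hs'
  · obtain ⟨k, hk⟩ := hinf.nonempty
    exact ⟨_, by positivity, (hmem k).2, hs' k hk⟩

theorem mem_affineSpan_of_segment {s : Set E} {c q : E} {r : ℝ} (hr : 0 < r)
    (hc : c ∈ convexHull ℝ s) (h : c + r • (q - c) ∈ convexHull ℝ s) : q ∈ affineSpan ℝ s := by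
  have := add_smul_sub_mem_affineSpan (mem_affineSpan_of_mem_convexHull hc)
    (mem_affineSpan_of_mem_convexHull h) r⁻¹
  rwa [add_sub_cancel_left, smul_smul, inv_mul_cancel₀ hr.ne', one_smul, add_sub_cancel] at this

/-- A point of `P` outside the affine spans of all simplices that do not span `P`. -/
def IsGeneric (P : Set E) (K : Finset (Finset E)) (q : E) : Prop :=
  q ∈ P ∧ ∀ t ∈ K, q ∈ affineSpan ℝ (t : Set E) → t ∈ fullSimplices P K

theorem exists_isGeneric (hK : Triangulates P K) : ∃ q, IsGeneric P K q := by
  obtain ⟨q, hq, h⟩ := exists_mem_forall_notMem hK.convex hK.nonempty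
    ((K \ fullSimplices P K).image fun t : Finset E => affineSpan ℝ (t : Set E)) (by
      simp only [Finset.mem_image, Finset.mem_sdiff, fullSimplices, Finset.mem_filter]
      rintro _ ⟨t, ⟨ht, ht'⟩, rfl⟩ hsub
      exact ht' ⟨ht, hsub⟩)
  refine ⟨q, hq, fun t ht hqt => ?_⟩
  by_contra hfull
  exact h _ (Finset.mem_image_of_mem _ (Finset.mem_sdiff.2 ⟨ht, hfull⟩)) hqt

theorem erase_notMem_fullSimplices (hK : Triangulates P K) {s : Finset E} (hs : s ∈ K) {x : E}
    (hx : x ∈ s) : s.erase x ∉ fullSimplices P K := by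
  intro h
  have hxm := (Finset.mem_filter.1 h).2 (hK.subset s hs hx)
  have h0 := bary_eq_zero_of_mem_affineSpan (hK.indep s hs) (Finset.erase_subset x s) hxm hx
    (Finset.notMem_erase x s)
  have h1 := bary_eq (hK.indep s hs) (p := x) (w := fun y => if y = x then 1 else 0)
    (by simp [hx]) (by simp [hx]) hx
  simp [h0] at h1

/-- A vanishing coordinate would put q in the affine span of a facet, which does not span P. -/
theorem bary_ne_zero_of_isGeneric (hK : Triangulates P K) {q : E} (hq : IsGeneric P K q)
    {s : Finset E} (hs : s ∈ fullSimplices P K) {x : E} (hx : x ∈ s) : bary s q x ≠ 0 := by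
  obtain ⟨hsK, hsP⟩ := Finset.mem_filter.1 hs
  intro h0
  refine hK.erase_notMem_fullSimplices hsK hx
    (hq.2 _ (hK.down_closed s hsK _ (Finset.erase_subset x s)) ?_)
  refine mem_affineSpan_of_bary_eq_zero (Finset.erase_subset x s) (hsP hq.1) fun y hy hy' => ?_
  have : y = x := by simpa [hy] using hy'
  rwa [this]

/-- Every point of `P` lies in a full-dimensional simplex. -/
theorem exists_full_mem (hK : Triangulates P K) {p : E} (hp : p ∈ P) :
    ∃ s ∈ fullSimplices P K, p ∈ convexHull ℝ (s : Set E) := by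
  obtain ⟨q, hq⟩ := hK.exists_isGeneric
  -- A simplex containing an initial piece of the segment from p to the generic q has q in its
  -- affine span, so it must be full-dimensional.
  obtain ⟨s, hs, hps, r, hr, -, hrs⟩ := hK.exists_initial_segment hp hq.1
  exact ⟨s, hq.2 s hs (mem_affineSpan_of_segment hr hps hrs), hps⟩

/-- Distinct simplices have disjoint relative interiors. -/
theorem eq_of_bary_pos (hK : Triangulates P K) {s t : Finset E} (hs : s ∈ K) (ht : t ∈ K) {p : E}
    (hps : p ∈ affineSpan ℝ (s : Set E)) (hpt : p ∈ affineSpan ℝ (t : Set E))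
    (hs0 : ∀ x ∈ s, 0 < bary s p x) (ht0 : ∀ x ∈ t, 0 < bary t p x) : s = t := by
  have h1 := mem_convexHull_of_bary_nonneg hps fun x hx => (hs0 x hx).le
  have h2 := mem_convexHull_of_bary_nonneg hpt fun x hx => (ht0 x hx).le
  exact Finset.Subset.antisymm (fun x hx => hK.subset_of_bary_pos hs ht h1 h2 hx (hs0 x hx))
    (fun x hx => hK.subset_of_bary_pos ht hs h2 h1 hx (ht0 x hx))

/-- Each simplex `Q` is, seen from a generic point `q`, on the far side of exactly one
full-dimensional simplex. -/
theorem exists_full_bary_pos (hK : Triangulates P K) {q : E} (hq : IsGeneric P K q)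
    {Q : Finset E} (hQ : Q ∈ K) :
    ∃ s ∈ fullSimplices P K, Q ⊆ s ∧ ∀ x ∈ s, x ∉ Q → 0 < bary s q x := by
  rcases Q.eq_empty_or_nonempty with rfl | hne
  · obtain ⟨s, hs, hqs⟩ := hK.exists_full_mem hq.1
    refine ⟨s, hs, Finset.empty_subset _, fun x hx _ => ?_⟩
    exact (bary_nonneg (hK.indep s (Finset.mem_filter.1 hs).1) hqs hx).lt_of_ne'
      (hK.bary_ne_zero_of_isGeneric hq hs hx)
  · have hc := average_mem_convexHull hne
    obtain ⟨s, hsK, hcs, r, hr, hr1, hrs⟩ :=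
      hK.exists_initial_segment (hK.convexHull_subset hQ hc) hq.1
    have hqs := mem_affineSpan_of_segment hr hcs hrs
    have hs := hq.2 s hsK hqs
    have hQs := hK.subset_of_average_mem hQ hsK hne hcs
    refine ⟨s, hs, hQs, fun x hx hxQ => ?_⟩
    have hb := bary_nonneg (hK.indep s hsK) hrs hx
    rw [bary_add_smul_sub (hK.indep s hsK) (mem_affineSpan_of_mem_convexHull hcs) hqs r hx,
      bary_average (hK.indep s hsK) hQs hne hx, if_neg hxQ, mul_zero, zero_add] at hb
    exact (nonneg_of_mul_nonneg_right hb hr).lt_of_ne' (hK.bary_ne_zero_of_isGeneric hq hs hx)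

/-- Uniqueness for `exists_full_bary_pos`: points just beyond the barycentre of Q towards q lie in
the relative interior of both s and t. Coordinates at vertices of Q stay near 1/|Q|; the others are
r times a positive number. -/
theorem eq_of_full_bary_pos (hK : Triangulates P K) {q : E} (hq : IsGeneric P K q)
    {Q s t : Finset E} (hs : s ∈ fullSimplices P K) (ht : t ∈ fullSimplices P K) (hQs : Q ⊆ s)
    (hQt : Q ⊆ t) (hs0 : ∀ x ∈ s, x ∉ Q → 0 < bary s q x)
    (ht0 : ∀ x ∈ t, x ∉ Q → 0 < bary t q x) : s = t := by
  obtain ⟨hsK, hsP⟩ := Finset.mem_filter.1 hs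
  obtain ⟨htK, htP⟩ := Finset.mem_filter.1 ht
  rcases Q.eq_empty_or_nonempty with rfl | hne
  · exact hK.eq_of_bary_pos hsK htK (hsP hq.1) (htP hq.1) (fun x hx => hs0 x hx (by simp))
      (fun x hx => ht0 x hx (by simp))
  · have hcP : average Q ∈ P :=
      hK.convexHull_subset (hK.down_closed s hsK Q hQs) (average_mem_convexHull hne)
    have hpos : (0 : ℝ) < (Q.card : ℝ)⁻¹ := by have := Finset.card_pos.2 hne; positivity
    have key : ∀ u ∈ fullSimplices P K, Q ⊆ u → (∀ x ∈ u, x ∉ Q → 0 < bary u q x) →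
        ∀ᶠ r in nhdsWithin (0 : ℝ) (Set.Ioi 0),
          ∀ x ∈ u, 0 < bary u (average Q + r • (q - average Q)) x := by
      intro u hu hQu hu0
      obtain ⟨huK, huP⟩ := Finset.mem_filter.1 hu
      rw [Filter.eventually_all_finset]
      intro x hx
      by_cases hxQ : x ∈ Q
      · have hcont : Filter.Tendsto (fun r : ℝ => (1 - r) * (Q.card : ℝ)⁻¹ + r * bary u q x)
            (nhdsWithin 0 (Set.Ioi 0)) (nhds ((1 - 0) * (Q.card : ℝ)⁻¹ + 0 * bary u q x)) :=
          tendsto_nhdsWithin_of_tendsto_nhds (Continuous.tendsto (by fun_prop) 0)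
        filter_upwards [hcont.eventually (lt_mem_nhds (a := 0) (by linarith))] with r hr
        rwa [bary_add_smul_sub (hK.indep u huK) (huP hcP) (huP hq.1) r hx,
          bary_average (hK.indep u huK) hQu hne hx, if_pos hxQ]
      · filter_upwards [self_mem_nhdsWithin] with r hr
        rw [bary_add_smul_sub (hK.indep u huK) (huP hcP) (huP hq.1) r hx,
          bary_average (hK.indep u huK) hQu hne hx, if_neg hxQ, mul_zero, zero_add]
        exact mul_pos hr (hu0 x hx hxQ)
    obtain ⟨r, hr, hr'⟩ := ((key s hs hQs hs0).and (key t ht hQt ht0)).exists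
    exact hK.eq_of_bary_pos hsK htK (add_smul_sub_mem_affineSpan (hsP hcP) (hsP hq.1) r)
      (add_smul_sub_mem_affineSpan (htP hcP) (htP hq.1) r) hr hr'

/-- The vertices of `s` opposite to the facets that are visible from `q`. -/
def visible (q : E) (s : Finset E) : Finset E := {x ∈ s | bary s q x < 0}

/-- For Q ⊆ s, genericity makes positivity of the coordinates of q off Q the same as `visible q s ⊆
Q`. Thus the simplex supplied by `exists_full_bary_pos` is one whose interval contains Q. -/
theorem eq_biUnion_Icc (hK : Triangulates P K) {q : E} (hq : IsGeneric P K q) :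
    K = (fullSimplices P K).biUnion fun s => Finset.Icc (visible q s) s := by
  ext Q
  simp only [Finset.mem_biUnion, Finset.mem_Icc]
  constructor
  · intro hQ
    obtain ⟨s, hs, hQs, h⟩ := hK.exists_full_bary_pos hq hQ
    refine ⟨s, hs, fun x hx => ?_, hQs⟩
    obtain ⟨hxs, hx0⟩ := Finset.mem_filter.1 hx
    by_contra hxQ
    exact lt_asymm hx0 (h x hxs hxQ)
  · rintro ⟨s, hs, -, hQs⟩
    exact hK.down_closed s (Finset.mem_filter.1 hs).1 Q hQs

theorem pos_of_visible_subset (hK : Triangulates P K) {q : E} (hq : IsGeneric P K q)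
    {Q s : Finset E} (hs : s ∈ fullSimplices P K) (h : visible q s ⊆ Q) :
    ∀ x ∈ s, x ∉ Q → 0 < bary s q x := by
  intro x hx hxQ
  refine lt_of_le_of_ne (not_lt.1 fun hlt => hxQ (h ?_))
    (hK.bary_ne_zero_of_isGeneric hq hs hx).symm
  exact Finset.mem_filter.2 ⟨hx, hlt⟩

theorem pairwiseDisjoint_Icc (hK : Triangulates P K) {q : E} (hq : IsGeneric P K q) :
    Set.PairwiseDisjoint (fullSimplices P K : Set (Finset E))
      fun s => Finset.Icc (visible q s) s := by
  intro s hs t ht hst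
  rw [Function.onFun, Finset.disjoint_left]
  intro Q hQs hQt
  simp only [Finset.mem_Icc] at hQs hQt
  exact hst (hK.eq_of_full_bary_pos hq hs ht hQs.2 hQt.2 (hK.pos_of_visible_subset hq hs hQs.1)
    (hK.pos_of_visible_subset hq ht hQt.1))

/-- A full-dimensional simplex has no visible facet exactly when its interval contains ∅, and the
intervals partition K. -/
theorem card_filter_visible_eq_empty (hK : Triangulates P K) {q : E} (hq : IsGeneric P K q) :
    ((fullSimplices P K).filter fun s => (visible q s).card = 0).card = 1 := by
  have h0 : (∅ : Finset E) ∈ K := by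
    obtain ⟨s, hs, -⟩ := hK.cover q hq.1
    exact hK.down_closed s hs _ (Finset.empty_subset s)
  rw [hK.eq_biUnion_Icc hq, Finset.mem_biUnion] at h0
  obtain ⟨s, hs, h0⟩ := h0
  rw [Finset.card_eq_one]
  refine ⟨s, Finset.ext fun t => ?_⟩
  simp only [Finset.mem_filter, Finset.mem_singleton, Finset.card_eq_zero]
  constructor
  · rintro ⟨ht, ht0⟩
    by_contra hne
    exact Finset.disjoint_left.1 (hK.pairwiseDisjoint_Icc hq ht hs hne)
      (by simp [ht0] : ∅ ∈ Finset.Icc (visible q t) t) h0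
  · rintro rfl
    exact ⟨hs, by simpa using h0⟩

end Triangulates

-- Weights of simplices and their sums over intervals.

/-- The number of interior points of level `N` in a simplex with `k` vertices. -/
def interiorCount (N : ℕ) : ℕ → ℕ
  | 0 => 0
  | k + 1 => N.choose k

theorem interiorCount_succ_succ (N k : ℕ) :
    interiorCount (N + 1) (k + 1) = interiorCount N k + interiorCount N (k + 1) := by
  cases k with
  | zero => simp [interiorCount]
  | succ k => simp [interiorCount, Nat.choose_succ_succ]

theorem sum_powerset_interiorCount {α : Type*} (t : Finset α) (N i : ℕ) :
    ∑ u ∈ t.powerset, interiorCount N (u.card + i) = interiorCount (N + t.card) (i + t.card) := by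
  induction t using Finset.induction_on generalizing N i with
  | empty => simp
  | insert a t ha ih =>
    rw [Finset.sum_powerset_insert ha, ← Finset.sum_add_distrib, Finset.card_insert_of_notMem ha]
    -- Pascal's rule merges the terms of u and of u with a added into one term with both parameters
    -- raised by one.
    have h := ih (N + 1) (i + 1)
    rw [show N + (t.card + 1) = N + 1 + t.card by ring,
      show i + (t.card + 1) = i + 1 + t.card by ring, ← h]
    refine Finset.sum_congr rfl fun u hu => ?_
    have hau : a ∉ u := fun hm => ha (Finset.mem_powerset.1 hu hm)
    rw [Finset.card_insert_of_notMem hau, ← add_assoc, interiorCount_succ_succ,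
      show u.card + 1 + i = u.card + i + 1 by ring]

theorem sum_Icc_interiorCount {α : Type*} {r s : Finset α} (h : r ⊆ s) (N : ℕ) :
    ∑ u ∈ Finset.Icc r s, interiorCount N u.card
      = interiorCount (N + (s.card - r.card)) s.card := by
  rw [Finset.Icc_eq_image_powerset h, Finset.sum_image]
  · have h1 : ∀ u ∈ (s \ r).powerset,
        interiorCount N (r ∪ u).card = interiorCount N (u.card + r.card) := by
      intro u hu
      rw [Finset.card_union_of_disjoint, add_comm]
      exact Finset.disjoint_left.2 fun x hx hxu =>
        (Finset.mem_sdiff.1 (Finset.mem_powerset.1 hu hxu)).2 hx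
    rw [Finset.sum_congr rfl h1, sum_powerset_interiorCount, Finset.card_sdiff_of_subset h,
      Nat.add_sub_cancel' (Finset.card_le_card h)]
  · intro u hu u' hu' he
    have key : ∀ w ∈ (s \ r).powerset, (r ∪ w) \ r = w := by
      intro w hw
      rw [Finset.union_sdiff_left, Finset.sdiff_eq_self_iff_disjoint]
      exact Finset.disjoint_left.2 fun x hx => (Finset.mem_sdiff.1 (Finset.mem_powerset.1 hw hx)).2
    simp only at he
    rw [← key u hu, he, key u' hu']

theorem Triangulates.sum_interiorCount {P : Set E} {K : Finset (Finset E)}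
    (hK : Triangulates P K) {q : E} (hq : Triangulates.IsGeneric P K q) (N : ℕ) :
    ∑ u ∈ K, interiorCount N u.card = ∑ s ∈ fullSimplices P K,
      interiorCount (N + (s.card - (Triangulates.visible q s).card)) s.card := by
  conv_lhs => rw [hK.eq_biUnion_Icc hq]
  rw [Finset.sum_biUnion (hK.pairwiseDisjoint_Icc hq)]
  exact Finset.sum_congr rfl fun s _ => sum_Icc_interiorCount (Finset.filter_subset _ _) N

-- Faces of polytopes.

theorem IsFace.exists_eq {P F : Set E} (hF : IsFace P F) (hne : F.Nonempty) :
    ∃ (l : E →L[ℝ] ℝ) (M : ℝ), (∀ x ∈ P, l x ≤ M) ∧ F = {x ∈ P | l x = M} := by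
  obtain ⟨l, hl⟩ := hF hne
  obtain ⟨x₀, hx₀⟩ := hne
  rw [hl] at hx₀
  refine ⟨l, l x₀, hx₀.2, ?_⟩
  rw [hl]
  ext x
  refine and_congr_right fun hx => ⟨fun h => le_antisymm (hx₀.2 x hx) (h x₀ hx₀.1),
    fun h y hy => ?_⟩
  rw [h]
  exact hx₀.2 y hy

theorem isFace_setOf_eq {P : Set E} (l : E →L[ℝ] ℝ) {M : ℝ} (h : ∀ x ∈ P, l x ≤ M) :
    IsFace P {x ∈ P | l x = M} := by
  rintro ⟨x₀, hx₀, rfl⟩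
  refine ⟨l, Set.ext fun x => and_congr_right fun hx => ?_⟩
  exact ⟨fun he y hy => he ▸ h y hy, fun hle => le_antisymm (h x hx) (hle x₀ hx₀)⟩

/-- In a convex combination attaining the maximum of l, only points attaining it can carry positive
weight. -/
theorem mem_convexHull_filter_of_eq {A : Finset E} (l : E →L[ℝ] ℝ) {M : ℝ}
    (h : ∀ a ∈ A, l a ≤ M) {x : E} (hx : x ∈ convexHull ℝ (A : Set E)) (hxM : l x = M) :
    x ∈ convexHull ℝ ((A.filter fun a => l a = M : Finset E) : Set E) := by
  obtain ⟨w, hw0, hw1, rfl⟩ := Finset.mem_convexHull'.1 hx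
  have hsum : ∑ a ∈ A, w a * (M - l a) = 0 := by
    simp only [map_sum, map_smul, smul_eq_mul] at hxM
    simp only [mul_sub, Finset.sum_sub_distrib, hxM, ← Finset.sum_mul, hw1, one_mul, sub_self]
  have hz : ∀ a ∈ A, ¬ l a = M → w a = 0 := by
    intro a ha hne
    have := (Finset.sum_eq_zero_iff_of_nonneg fun b hb =>
      mul_nonneg (hw0 b hb) (sub_nonneg.2 (h b hb))).1 hsum a ha
    exact (mul_eq_zero.1 this).resolve_right (sub_ne_zero.2 (Ne.symm hne))
  refine Finset.mem_convexHull'.2 ⟨w, fun a ha => hw0 a (Finset.mem_filter.1 ha).1, ?_, ?_⟩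
  · rw [← hw1]
    refine Finset.sum_subset (Finset.filter_subset _ _) fun a ha ha' => hz a ha fun he => ha' ?_
    exact Finset.mem_filter.2 ⟨ha, he⟩
  · refine Finset.sum_subset (Finset.filter_subset _ _) fun a ha ha' => ?_
    rw [hz a ha fun he => ha' (Finset.mem_filter.2 ⟨ha, he⟩), zero_smul]

theorem IsFace.eq_convexHull_filter {A : Finset E} {F : Set E}
    (hF : IsFace (convexHull ℝ (A : Set E)) F) :
    F = convexHull ℝ ((A.filter (· ∈ F) : Finset E) : Set E) := by
  rcases F.eq_empty_or_nonempty with rfl | hne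
  · simp
  have hsub : convexHull ℝ ((A.filter (· ∈ F) : Finset E) : Set E) ⊆ F :=
    convexHull_min (fun a ha => (Finset.mem_filter.1 ha).2)
      (IsExposed.convex hF (convex_convexHull ℝ _))
  refine Set.Subset.antisymm (fun x hx => ?_) hsub
  obtain ⟨l, M, hM, hFl⟩ := hF.exists_eq hne
  rw [hFl] at hx
  refine convexHull_mono ?_ (mem_convexHull_filter_of_eq l
    (fun a ha => hM a (subset_convexHull ℝ _ ha)) hx.1 hx.2)
  intro a ha
  obtain ⟨ha, hla⟩ := Finset.mem_filter.1 ha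
  refine Finset.mem_filter.2 ⟨ha, ?_⟩
  rw [hFl]
  exact ⟨subset_convexHull ℝ _ ha, hla⟩

theorem IsFace.exists_subset {A : Finset E} {F : Set E}
    (hF : IsFace (convexHull ℝ (A : Set E)) F) :
    ∃ B ⊆ A, F = convexHull ℝ (B : Set E) :=
  ⟨_, Finset.filter_subset _ _, hF.eq_convexHull_filter⟩

theorem IsPolytope.finite_faces {P : Set E} (hP : IsPolytope P) : (faces P).Finite := by
  obtain ⟨A, rfl⟩ := hP
  refine (A.powerset.finite_toSet.image fun B : Finset E => convexHull ℝ (B : Set E)).subset ?_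
  rintro F ⟨hF, -⟩
  exact ⟨A.filter (· ∈ F), Finset.mem_powerset.2 (Finset.filter_subset _ _),
    hF.eq_convexHull_filter.symm⟩

theorem IsPolytope.isPolytope_of_isFace {P F : Set E} (hP : IsPolytope P) (hF : IsFace P F) :
    IsPolytope F := by
  obtain ⟨A, rfl⟩ := hP
  exact ⟨_, hF.eq_convexHull_filter⟩

theorem IsPolytope.convex {P : Set E} (hP : IsPolytope P) : Convex ℝ P := by
  obtain ⟨A, rfl⟩ := hP
  exact convex_convexHull ℝ _

/-- A face of a face of a polytope is a face. -/
theorem IsPolytope.isFace_trans {P F G : Set E} (hP : IsPolytope P) (hF : IsFace P F)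
    (hG : IsFace F G) : IsFace P G := by
  rcases G.eq_empty_or_nonempty with rfl | hGne
  · exact isExposed_empty
  have hGF : G ⊆ F := IsExposed.subset hG
  obtain ⟨l, M, hM, hFl⟩ := hF.exists_eq (hGne.mono hGF)
  obtain ⟨m, N, hN, hGm⟩ := hG.exists_eq hGne
  obtain ⟨A, rfl⟩ := hP
  have hA : ∀ a ∈ A, a ∈ convexHull ℝ (A : Set E) := fun a ha => subset_convexHull ℝ _ ha
  -- With r this large, r l + m attains its maximum over A only where l does, and among those points
  -- only where m does.
  obtain ⟨r, hr⟩ : ∃ r : ℝ, ∀ a ∈ A, l a ≠ M → m a - N < r * (M - l a) := by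
    obtain ⟨r, hr⟩ := (A.finite_toSet.image fun a => (m a - N) / (M - l a)).bddAbove
    refine ⟨r + 1, fun a ha hne => ?_⟩
    have hpos : 0 < M - l a := sub_pos.2 (lt_of_le_of_ne (hM a (hA a ha)) hne)
    rw [← div_lt_iff₀ hpos]
    exact lt_of_le_of_lt (hr ⟨a, ha, rfl⟩) (lt_add_one r)
  have hle : ∀ a ∈ A, (r • l + m) a ≤ r * M + N := by
    intro a ha
    simp only [add_apply, smul_apply, smul_eq_mul]
    by_cases h : l a = M
    · have := hN a (by rw [hFl]; exact ⟨hA a ha, h⟩)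
      rw [h]
      linarith
    · linarith [hr a ha h, mul_sub r M (l a)]
  have hleP : ∀ x ∈ convexHull ℝ (A : Set E), (r • l + m) x ≤ r * M + N := fun x hx =>
    convexHull_min (t := {x | (r • l + m) x ≤ r * M + N}) hle
      (convex_halfSpace_le (r • l + m).toLinearMap.isLinear _) hx
  have hGeq : G = {x ∈ convexHull ℝ (A : Set E) | (r • l + m) x = r * M + N} := by
    refine Set.Subset.antisymm (fun x hx => ?_) ?_
    · have hxF := hGF hx
      rw [hGm] at hx
      rw [hFl] at hxF
      refine ⟨hxF.1, ?_⟩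
      simp [hxF.2, hx.2]
    · rintro x ⟨hx, hxe⟩
      refine convexHull_min ?_ (IsExposed.convex hG (IsExposed.convex hF (convex_convexHull ℝ _)))
        (mem_convexHull_filter_of_eq _ hle hx hxe)
      intro a ha
      obtain ⟨ha, hae⟩ := Finset.mem_filter.1 ha
      simp only [add_apply, smul_apply, smul_eq_mul] at hae
      have hl : l a = M := by
        by_contra h
        linarith [hr a ha h, mul_sub r M (l a)]
      rw [hGm, hFl]
      refine ⟨⟨hA a ha, hl⟩, ?_⟩
      rw [hl] at hae
      linarith
  rw [hGeq]
  exact isFace_setOf_eq _ hleP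

theorem IsFace.subset_of_average_mem {P F : Set E} (hF : IsFace P F) {s : Finset E}
    (hne : s.Nonempty) (hsP : (s : Set E) ⊆ P) (h : average s ∈ F) : (s : Set E) ⊆ F := by
  obtain ⟨l, M, hM, hFl⟩ := hF.exists_eq ⟨_, h⟩
  have hl : l (average s) = M := by
    rw [hFl] at h
    exact h.2
  have hsum : ∑ x ∈ s, (s.card : ℝ)⁻¹ * (M - l x) = 0 := by
    simp only [average, map_sum, map_smul, smul_eq_mul] at hl
    simp only [mul_sub, Finset.sum_sub_distrib, hl, ← Finset.sum_mul, sum_average_weights hne,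
      one_mul, sub_self]
  intro x hx
  have := (Finset.sum_eq_zero_iff_of_nonneg fun y hy =>
    mul_nonneg (by positivity) (sub_nonneg.2 (hM y (hsP hy)))).1 hsum x hx
  rw [hFl]
  refine ⟨hsP hx, ?_⟩
  rcases mul_eq_zero.1 this with h0 | h0
  · simp [hne.ne_empty] at h0
  · linarith

/-- If no proper face of a convex set `G` contains `z`, then any segment in `G` ending at `z` can
be prolonged in `G` beyond `z`. -/
theorem exists_add_smul_sub_mem [FiniteDimensional ℝ E] {G : Set E} (hG : Convex ℝ G) {z v : E}
    (hz : z ∈ G) (hv : v ∈ G) (h : ∀ H, IsFace G H → z ∈ H → H = G) :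
    ∃ r : ℝ, 0 < r ∧ z + r • (z - v) ∈ G := by
  set S : Set E := (fun x => x - z) '' G with hS
  have hSconv : Convex ℝ S := by
    have := hG.translate (-z)
    simpa [hS, sub_eq_neg_add] using this
  -- G may have empty interior in E; translated by -z and viewed in its own linear span it has
  -- interior points.
  set G' : Set (Submodule.span ℝ S) := (↑) ⁻¹' S with hG'
  have hconv : Convex ℝ G' := hSconv.linear_preimage (Submodule.span ℝ S).subtype
  have h0S : (0 : E) ∈ S := ⟨z, hz, sub_self z⟩
  have h0 : (0 : Submodule.span ℝ S) ∈ G' := by simpa [hG'] using h0S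
  have hspan : affineSpan ℝ G' = ⊤ := by
    rw [AffineSubspace.affineSpan_eq_top_iff_vectorSpan_eq_top_of_nonempty ℝ _ _ ⟨0, h0⟩,
      vectorSpan_eq_span_vsub_set_right ℝ h0]
    simpa only [vsub_eq_sub, sub_zero, Set.image_id'] using
      Submodule.span_span_coe_preimage (R := ℝ) (s := S)
  have hint : (interior G').Nonempty := hconv.interior_nonempty_iff_affineSpan_eq_top.2 hspan
  let v' : Submodule.span ℝ S := ⟨v - z, Submodule.subset_span ⟨v, hv, rfl⟩⟩
  by_cases hmem : (0 : Submodule.span ℝ S) ∈ interior G'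
  · have hlim : Filter.Tendsto (fun r : ℝ => (-r) • v') (nhdsWithin 0 (Set.Ioi 0))
        (nhds ((-0 : ℝ) • v')) :=
      tendsto_nhdsWithin_of_tendsto_nhds (Continuous.tendsto (by fun_prop) 0)
    rw [neg_zero, zero_smul] at hlim
    obtain ⟨r, hr, hr0⟩ := ((hlim.eventually (mem_interior_iff_mem_nhds.1 hmem)).and
      self_mem_nhdsWithin).exists
    refine ⟨r, hr0, ?_⟩
    obtain ⟨g, hg, hgr⟩ := hr
    have : z + r • (z - v) = g := by
      have h2 : g - z = (-r) • (v - z) := hgr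
      rw [eq_add_of_sub_eq h2]
      module
    rwa [this]
  · exfalso
    -- If z is not interior, a supporting form at z, extended to E, exposes a face containing z. By
    -- hypothesis that face is all of G, so the form is constant on G, although it is negative at
    -- interior points.
    obtain ⟨f, hf⟩ := geometric_hahn_banach_open_point hconv.interior isOpen_interior hmem
    have hfle : ∀ a ∈ G', f a ≤ 0 := by
      intro a ha
      have hcl : a ∈ closure (interior G') := by
        rw [hconv.closure_interior_eq_closure_of_nonempty_interior hint]
        exact subset_closure ha
      refine closure_minimal (t := {a | f a ≤ 0}) (fun b hb => ?_)
        (isClosed_le f.continuous continuous_const) hcl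
      simpa using (hf b hb).le
    obtain ⟨g, hg⟩ := f.toLinearMap.exists_extend
    have hgf : ∀ x (hx : x ∈ Submodule.span ℝ S), g x = f ⟨x, hx⟩ := fun x hx =>
      congrArg (fun k => k ⟨x, hx⟩) hg
    have hle : ∀ x ∈ G, (LinearMap.toContinuousLinearMap g) x
        ≤ (LinearMap.toContinuousLinearMap g) z := by
      intro x hx
      have hxS : x - z ∈ S := ⟨x, hx, rfl⟩
      have := hfle ⟨x - z, Submodule.subset_span hxS⟩ hxS
      rw [← hgf, map_sub] at this
      simpa using this
    have key : ∀ x ∈ G, g x = g z := by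
      have hG' := h _ (isFace_setOf_eq _ hle) ⟨hz, rfl⟩
      intro x hx
      rw [← hG'] at hx
      exact hx.2
    obtain ⟨b, hb⟩ := hint
    have hbS : b ∈ G' := interior_subset hb
    obtain ⟨x, hx, hxb⟩ := hbS
    have h1 := hf b hb
    have h2 : g b = f b := hgf b b.2
    have h3 : g b = 0 := by rw [← hxb, map_sub, key x hx, sub_self]
    rw [h3] at h2
    simp [← h2] at h1

-- Faces and vertex sets of simplices.

/-- A linear form can be prescribed on an affinely independent set up to an additive constant. -/
theorem exists_linear_of_affineIndependent [FiniteDimensional ℝ E] {s : Finset E}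
    (hs : AffineIndependent ℝ ((↑) : s → E)) {x₀ : E} (hx₀ : x₀ ∈ s) (f : E → ℝ) :
    ∃ l : E →L[ℝ] ℝ, ∀ x ∈ s, l x - l x₀ = f x - f x₀ := by
  have hli := (affineIndependent_iff_linearIndependent_vsub ℝ ((↑) : s → E) ⟨x₀, hx₀⟩).1 hs
  obtain ⟨l, hl⟩ : ∃ l : E →ₗ[ℝ] ℝ, ∀ x : {x : s // x ≠ ⟨x₀, hx₀⟩},
      l ((x : s) - x₀) = f (x : s) - f x₀ := by
    obtain ⟨l, hl⟩ := ((Module.Basis.span hli).constr ℝ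
      fun x => f (x : s) - f x₀ : _ →ₗ[ℝ] ℝ).exists_extend
    refine ⟨l, fun x => ?_⟩
    have h1 := congrArg (fun k => k (Module.Basis.span hli x)) hl
    simp only [LinearMap.comp_apply, Submodule.subtype_apply, Module.Basis.constr_basis] at h1
    rwa [Module.Basis.span_apply] at h1
  refine ⟨LinearMap.toContinuousLinearMap l, fun x hx => ?_⟩
  by_cases hxx : x = x₀
  · simp [hxx]
  · have := hl ⟨⟨x, hx⟩, by simpa using hxx⟩
    simpa using this

theorem isFace_convexHull_of_subset [FiniteDimensional ℝ E] {s t : Finset E}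
    (hs : AffineIndependent ℝ ((↑) : s → E)) (hts : t ⊆ s) :
    IsFace (convexHull ℝ (s : Set E)) (convexHull ℝ (t : Set E)) := by
  rcases t.eq_empty_or_nonempty with rfl | ⟨x₀, hx₀⟩
  · rw [Finset.coe_empty, convexHull_empty]
    exact isExposed_empty
  -- Up to a constant, l is the indicator of t on s, hence is maximal on s exactly at t.
  obtain ⟨l, hl⟩ := exists_linear_of_affineIndependent hs (hts hx₀) fun x => if x ∈ t then 1 else 0
  have hlt : ∀ x ∈ t, l x = l x₀ := fun x hx => by
    have := hl x (hts hx)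
    simp only [hx, hx₀, if_true] at this
    linarith
  have hls : ∀ x ∈ s, x ∉ t → l x < l x₀ := fun x hx hxt => by
    have := hl x hx
    simp only [hxt, hx₀, if_true, if_false] at this
    linarith
  have hle : ∀ x ∈ s, l x ≤ l x₀ := fun x hx => by
    by_cases hxt : x ∈ t
    · exact (hlt x hxt).le
    · exact (hls x hx hxt).le
  have heq : convexHull ℝ (t : Set E) = {x ∈ convexHull ℝ (s : Set E) | l x = l x₀} := by
    refine Set.Subset.antisymm (fun x hx => ⟨convexHull_mono (by exact_mod_cast hts) hx, ?_⟩) ?_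
    · exact convexHull_min (t := {x | l x = l x₀}) hlt
        (convex_hyperplane l.toLinearMap.isLinear _) hx
    · rintro x ⟨hx, hxe⟩
      refine convexHull_mono ?_ (mem_convexHull_filter_of_eq l hle hx hxe)
      intro a ha
      obtain ⟨ha, hae⟩ := Finset.mem_filter.1 ha
      by_contra hat
      exact (hls a ha hat).ne hae
  rw [heq]
  exact isFace_setOf_eq l fun x hx => convexHull_min (t := {x | l x ≤ l x₀}) hle
    (convex_halfSpace_le l.toLinearMap.isLinear _) hx

theorem vert_subset_of_convexHull {s : Set E} {x : E} (hx : x ∈ vert (convexHull ℝ s)) : x ∈ s :=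
  extremePoints_convexHull_subset (𝕜 := ℝ)
    (exposedPoints_subset_extremePoints (mem_exposedPoints_iff_exposed_singleton.2 hx))

theorem subset_of_convexHull_eq [FiniteDimensional ℝ E] {s t : Finset E}
    (hs : AffineIndependent ℝ ((↑) : s → E))
    (h : convexHull ℝ (s : Set E) = convexHull ℝ (t : Set E)) : s ⊆ t := by
  intro x hx
  have := isFace_convexHull_of_subset hs (Finset.singleton_subset_iff.2 hx)
  rw [h, Finset.coe_singleton, convexHull_singleton] at this
  exact_mod_cast vert_subset_of_convexHull this

theorem eq_of_convexHull_eq [FiniteDimensional ℝ E] {s t : Finset E}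
    (hs : AffineIndependent ℝ ((↑) : s → E)) (ht : AffineIndependent ℝ ((↑) : t → E))
    (h : convexHull ℝ (s : Set E) = convexHull ℝ (t : Set E)) : s = t :=
  Finset.Subset.antisymm (subset_of_convexHull_eq hs h) (subset_of_convexHull_eq ht h.symm)

/-- The vertex sets of the simplices in `C`. -/
def vertexSets (C : Set (Set E)) : Set (Finset E) :=
  {s | AffineIndependent ℝ ((↑) : s → E) ∧ convexHull ℝ (s : Set E) ∈ C}

theorem finite_vertexSets [FiniteDimensional ℝ E] {C : Set (Set E)} (hC : C.Finite) :
    (vertexSets C).Finite :=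
  Set.Finite.of_finite_image (f := fun s : Finset E => convexHull ℝ (s : Set E))
    (hC.subset (by rintro _ ⟨s, hs, rfl⟩; exact hs.2))
    fun _ hs _ ht h => eq_of_convexHull_eq hs.1 ht.1 h

theorem IsTriangulation.triangulates [FiniteDimensional ℝ E] {P : Set E} {C : Set (Set E)}
    (hC : IsTriangulation P C) (hP : Convex ℝ P) (hne : P.Nonempty) {K : Finset (Finset E)}
    (hK : ∀ s, s ∈ K ↔ s ∈ vertexSets C) : Triangulates P K where
  convex := hP
  nonempty := hne
  indep s hs := ((hK s).1 hs).1
  down_closed s hs t hts := by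
    obtain ⟨hsi, hsC⟩ := (hK s).1 hs
    refine (hK t).2 ⟨hsi.mono (by exact_mod_cast hts), ?_⟩
    exact hC.complex.face_mem _ hsC _ (isFace_convexHull_of_subset hsi hts)
  inter s hs t ht p hps hpt := by
    obtain ⟨hsi, hsC⟩ := (hK s).1 hs
    obtain ⟨hti, htC⟩ := (hK t).1 ht
    obtain ⟨h1, h2⟩ := hC.complex.inter_face _ hsC _ htC
    obtain ⟨u, hus, e1⟩ := h1.exists_subset
    obtain ⟨u', hut, e2⟩ := h2.exists_subset
    -- The common face is spanned by some vertices of s and also by some vertices of t; the two sets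
    -- agree because a simplex determines its vertices.
    have huu : u = u' := eq_of_convexHull_eq (hsi.mono (by exact_mod_cast hus))
      (hti.mono (by exact_mod_cast hut)) (e1.symm.trans e2)
    have hp : p ∈ convexHull ℝ (u : Set E) := e1 ▸ ⟨hps, hpt⟩
    exact convexHull_mono (by exact_mod_cast Finset.subset_inter hus (huu ▸ hut)) hp
  cover p hp := by
    rw [← hC.sUnion_eq] at hp
    obtain ⟨Q, hQ, hpQ⟩ := hp
    obtain ⟨s, hs, rfl⟩ := hC.simplex Q hQ
    exact ⟨s, (hK s).2 ⟨hs, hQ⟩, hpQ⟩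
  subset s hs := by
    rw [← hC.sUnion_eq]
    exact (subset_convexHull ℝ _).trans (Set.subset_sUnion_of_mem ((hK s).1 hs).2)

theorem IsPolytope.faces_subset {P F : Set E} (hP : IsPolytope P) (hF : F ∈ faces P) :
    faces F ⊆ faces P := fun _ hG => ⟨hP.isFace_trans hF.1 hG.1, hG.2⟩

theorem self_mem_faces {P : Set E} (hne : P.Nonempty) : P ∈ faces P := ⟨IsExposed.refl P, hne⟩

theorem mem_faces_of_subset {P F G : Set E} (hF : F ∈ faces P) (hG : G ∈ faces P) (h : G ⊆ F) :
    G ∈ faces F := ⟨IsExposed.mono hG.1 (IsExposed.subset hF.1) h, hG.2⟩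

theorem mem_of_mem_vert {P : Set E} {x : E} (hx : x ∈ vert P) : x ∈ P :=
  IsExposed.subset hx rfl

theorem vert_mono {P Q : Set E} {x : E} (hx : x ∈ vert P) (hQP : Q ⊆ P) (hxQ : x ∈ Q) :
    x ∈ vert Q := IsExposed.mono hx hQP (Set.singleton_subset_iff.2 hxQ)

-- Pointed complexes: cone structure and distribution of simplices among the faces.

/-- The simplices of `K` that lie in `F`. -/
def part (K : Finset (Finset E)) (F : Set E) : Finset (Finset E) := {s ∈ K | (s : Set E) ⊆ F}

/-- The nonempty simplices of `K` that lie in `F` but in no proper face of `F`. -/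
def innerPart (K : Finset (Finset E)) (F : Set E) : Finset (Finset E) :=
  {s ∈ part K F | s.Nonempty ∧ ∀ G ∈ faces F, (s : Set E) ⊆ G → G = F}

/-- `K` triangulates all faces of the polytope `P`, and the apex of each face is a vertex of all
full-dimensional simplices of that face. -/
structure IsPointed (P : Set E) (v : Set E → E) (K : Finset (Finset E)) : Prop where
  polytope : IsPolytope P
  nonempty : P.Nonempty
  triangulates : ∀ F ∈ faces P, Triangulates F (part K F)
  apex_mem_vert : ∀ F ∈ faces P, v F ∈ vert F
  apex_mem : ∀ F ∈ faces P, ∀ s ∈ fullSimplices F (part K F), v F ∈ s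

theorem vectorSpan_eq_of_spans {P : Set E} {s : Set E} (hsP : s ⊆ P)
    (hPs : P ⊆ affineSpan ℝ s) : vectorSpan ℝ s = vectorSpan ℝ P := by
  refine le_antisymm (vectorSpan_mono ℝ hsP) ?_
  rw [← direction_affineSpan ℝ s, ← direction_affineSpan ℝ P]
  exact AffineSubspace.direction_le (affineSpan_le.2 hPs)

theorem Triangulates.card_of_mem_fullSimplices {P : Set E} {K : Finset (Finset E)}
    (hK : Triangulates P K) {s : Finset E} (hs : s ∈ fullSimplices P K) :
    s.card = dim P + 1 := by
  obtain ⟨hsK, hsP⟩ := Finset.mem_filter.1 hs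
  have hne : s.Nonempty := by
    have h := affineSpan_nonempty (k := ℝ) (s := (s : Set E))
    exact_mod_cast h.1 (hK.nonempty.mono hsP)
  have : Nonempty s := hne.to_subtype
  have h := (hK.indep s hsK).finrank_vectorSpan_add_one
  rw [Subtype.range_coe_subtype, Finset.setOfPred_mem, Fintype.card_coe,
    vectorSpan_eq_of_spans (hK.subset s hsK) hsP] at h
  exact h.symm

/-- The apex is a vertex of F lying in each full-dimensional simplex of F, so it is a vertex of that
simplex and belongs to its vertex set. -/
theorem IsPointedTriangulation.isPointed [FiniteDimensional ℝ E] {P : Set E} {v : Set E → E}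
    {C : Set (Set E)} (hC : IsPointedTriangulation P v C) (hP : IsPolytope P) (hne : P.Nonempty) :
    IsPointed P v (finite_vertexSets hC.triangulation.complex.finite).toFinset where
  polytope := hP
  nonempty := hne
  triangulates F hF := by
    have hconv := (hP.isPolytope_of_isFace hF.1).convex
    refine (hC.face_triangulation F hF).triangulates hconv hF.2 fun s => ?_
    simp only [part, Finset.mem_filter, Set.Finite.mem_toFinset, vertexSets, restrict,
      Set.mem_ofPred_eq, hconv.convexHull_subset_iff, and_assoc]
  apex_mem_vert := hC.apex_mem_vert
  apex_mem F hF s hs := by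
    obtain ⟨hs, hFs⟩ := Finset.mem_filter.1 hs
    obtain ⟨hs, hsF⟩ := Finset.mem_filter.1 hs
    rw [Set.Finite.mem_toFinset] at hs
    have hconv := (hP.isPolytope_of_isFace hF.1).convex
    have hsub : convexHull ℝ (s : Set E) ⊆ F := convexHull_min hsF hconv
    have hsne : (s : Set E).Nonempty := (affineSpan_nonempty ℝ).1 (hF.2.mono hFs)
    have hdim : dim (convexHull ℝ (s : Set E)) = dim F := by
      rw [dim, dim, vectorSpan_eq_of_spans hsub (by rwa [affineSpan_convexHull])]
    have hv := hC.apex_mem F hF _ ⟨hs.2, hsub⟩ hsne.convexHull hdim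
    exact vert_subset_of_convexHull (vert_mono (hC.apex_mem_vert F hF) hsub hv)

namespace IsPointed

variable {P : Set E} {v : Set E → E} {K : Finset (Finset E)}

theorem face (h : IsPointed P v K) {F : Set E} (hF : F ∈ faces P) : IsPointed F v K where
  polytope := h.polytope.isPolytope_of_isFace hF.1
  nonempty := hF.2
  triangulates G hG := h.triangulates G (h.polytope.faces_subset hF hG)
  apex_mem_vert G hG := h.apex_mem_vert G (h.polytope.faces_subset hF hG)
  apex_mem G hG := h.apex_mem G (h.polytope.faces_subset hF hG)

theorem triangulates_self (h : IsPointed P v K) : Triangulates P (part K P) :=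
  h.triangulates P (self_mem_faces h.nonempty)

theorem apex_mem_vert_self (h : IsPointed P v K) : v P ∈ vert P :=
  h.apex_mem_vert P (self_mem_faces h.nonempty)

/-- A full-dimensional simplex through the barycentre of s contains s, and it has the apex as a
vertex. -/
theorem exists_full_superset (h : IsPointed P v K) {s : Finset E} (hs : s ∈ part K P) :
    ∃ t ∈ part K P, s ⊆ t ∧ v P ∈ t := by
  have hK := h.triangulates_self
  obtain ⟨p, hp, hps⟩ : ∃ p ∈ P, ∀ t ∈ part K P, p ∈ convexHull ℝ (t : Set E) → s ⊆ t := by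
    rcases s.eq_empty_or_nonempty with rfl | hne
    · obtain ⟨p, hp⟩ := h.nonempty
      exact ⟨p, hp, fun t _ _ => Finset.empty_subset t⟩
    · exact ⟨average s, hK.convexHull_subset hs (average_mem_convexHull hne),
        fun t ht hpt => hK.subset_of_average_mem hs ht hne hpt⟩
  obtain ⟨t, ht, hpt⟩ := hK.exists_full_mem hp
  have ht' := (Finset.mem_filter.1 ht).1
  exact ⟨t, ht', hps t ht' hpt, h.apex_mem P (self_mem_faces h.nonempty) t ht⟩

theorem insert_apex_mem (h : IsPointed P v K) {s : Finset E} (hs : s ∈ part K P) :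
    insert (v P) s ∈ part K P := by
  obtain ⟨t, ht, hst, hvt⟩ := h.exists_full_superset hs
  exact h.triangulates_self.down_closed t ht _ (Finset.insert_subset hvt hst)

/-- The complex is the cone with apex `v P` over its part missing `v P`. -/
theorem sum_part (h : IsPointed P v K) (N : ℕ) :
    ∑ s ∈ part K P, interiorCount N s.card
      = ∑ s ∈ part K P with v P ∉ s, interiorCount (N + 1) (s.card + 1) := by
  have hcone : ∑ s ∈ part K P with v P ∈ s, interiorCount N s.card
      = ∑ s ∈ part K P with v P ∉ s, interiorCount N (s.card + 1) := by
    symm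
    refine Finset.sum_bij' (fun s _ => insert (v P) s) (fun s _ => s.erase (v P)) ?_ ?_ ?_ ?_ ?_
    · intro s hs
      obtain ⟨hs, -⟩ := Finset.mem_filter.1 hs
      exact Finset.mem_filter.2 ⟨h.insert_apex_mem hs, Finset.mem_insert_self _ _⟩
    · intro s hs
      obtain ⟨hs, -⟩ := Finset.mem_filter.1 hs
      exact Finset.mem_filter.2 ⟨h.triangulates_self.down_closed s hs _ (Finset.erase_subset _ _),
        Finset.notMem_erase _ _⟩
    · intro s hs
      exact Finset.erase_insert (Finset.mem_filter.1 hs).2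
    · intro s hs
      exact Finset.insert_erase (Finset.mem_filter.1 hs).2
    · intro s hs
      rw [Finset.card_insert_of_notMem (Finset.mem_filter.1 hs).2]
  rw [← Finset.sum_filter_add_sum_filter_not (part K P) (fun s => v P ∈ s), hcone, add_comm,
    ← Finset.sum_add_distrib]
  exact Finset.sum_congr rfl fun s _ => (interiorCount_succ_succ _ _).symm

theorem empty_mem_part (h : IsPointed P v K) : ∅ ∈ part K P := by
  obtain ⟨p, hp⟩ := h.nonempty
  obtain ⟨s, hs, -⟩ := h.triangulates_self.cover p hp
  exact h.triangulates_self.down_closed s hs _ (Finset.empty_subset s)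

/-- The recursion at n = 2; the summand 1 stands for P(1) and comes from the vertex v P, the cone
over ∅. -/
theorem sum_part_zero (h : IsPointed P v K) :
    ∑ s ∈ part K P, interiorCount 0 s.card
      = 1 + ∑ s ∈ part K P with v P ∉ s, interiorCount 0 s.card := by
  rw [h.sum_part, Finset.sum_congr rfl fun s _ => interiorCount_succ_succ 0 s.card,
    Finset.sum_add_distrib, add_comm]
  congr 1
  rw [Finset.sum_eq_single ∅]
  · simp [interiorCount]
  · intro s _ hs
    exact Nat.choose_eq_zero_of_lt (Finset.card_pos.2 (Finset.nonempty_iff_ne_empty.2 hs))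
  · intro hs
    exact absurd (Finset.mem_filter.2 ⟨h.empty_mem_part, by simp⟩) hs

/-- The recursion P(n) = P(n - 1) + ... in terms of weights: the cone formula of `sum_part` at two
consecutive levels, linked by Pascal's rule. -/
theorem sum_part_succ (h : IsPointed P v K) (N : ℕ) :
    ∑ s ∈ part K P, interiorCount (N + 1) s.card
      = ∑ s ∈ part K P, interiorCount N s.card
        + ∑ s ∈ part K P with v P ∉ s, interiorCount (N + 1) s.card := by
  rw [h.sum_part (N + 1), Finset.sum_congr rfl fun s _ => interiorCount_succ_succ (N + 1) s.card,
    Finset.sum_add_distrib, add_comm, h.sum_part N]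

theorem exists_mem_innerPart (h : IsPointed P v K) {s : Finset E} (hs : s ∈ part K P)
    (hne : s.Nonempty) : ∃ F ∈ faces P, s ∈ innerPart K F := by
  have hfin : {F ∈ faces P | (s : Set E) ⊆ F}.Finite :=
    h.polytope.finite_faces.subset fun _ hF => hF.1
  obtain ⟨F, hF⟩ := hfin.exists_minimal
    ⟨P, self_mem_faces h.nonempty, (Finset.mem_filter.1 hs).2⟩
  refine ⟨F, hF.1.1, Finset.mem_filter.2 ⟨Finset.mem_filter.2 ⟨(Finset.mem_filter.1 hs).1,
    hF.1.2⟩, hne, fun G hG hsG => ?_⟩⟩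
  have hGF : G ⊆ F := IsExposed.subset hG.1
  exact Set.Subset.antisymm hGF (hF.2 ⟨h.polytope.faces_subset hF.1.1 hG, hsG⟩ hGF)

/-- F ∩ G is again a face containing s, so by minimality it equals both F and G. -/
theorem eq_of_mem_innerPart {F G : Set E} (hF : F ∈ faces P) (hG : G ∈ faces P) {s : Finset E}
    (hsF : s ∈ innerPart K F) (hsG : s ∈ innerPart K G) : F = G := by
  obtain ⟨hsF, hne, hFmin⟩ := Finset.mem_filter.1 hsF
  obtain ⟨hsG, -, hGmin⟩ := Finset.mem_filter.1 hsG
  have hsub : (s : Set E) ⊆ F ∩ G :=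
    Set.subset_inter (Finset.mem_filter.1 hsF).2 (Finset.mem_filter.1 hsG).2
  have hFG : F ∩ G ∈ faces P := ⟨IsExposed.inter hF.1 hG.1, (Finset.coe_nonempty.2 hne).mono hsub⟩
  rw [← hFmin _ (mem_faces_of_subset hF hFG Set.inter_subset_left) hsub]
  exact hGmin _ (mem_faces_of_subset hG hFG Set.inter_subset_right) hsub

theorem apex_mem_of_mem_innerPart [FiniteDimensional ℝ E] (h : IsPointed P v K) {G : Set E}
    (hG : G ∈ faces P) {s : Finset E} (hs : s ∈ innerPart K G) (hv : v P ∈ G) : v P ∈ s := by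
  obtain ⟨hs, hne, hmin⟩ := Finset.mem_filter.1 hs
  obtain ⟨hsK, hsG⟩ := Finset.mem_filter.1 hs
  have hGP : G ⊆ P := IsExposed.subset hG.1
  have hsP : s ∈ part K P := Finset.mem_filter.2 ⟨hsK, hsG.trans hGP⟩
  have hK := h.triangulates_self
  have hGconv := (h.polytope.isPolytope_of_isFace hG.1).convex
  have hzs := average_mem_convexHull hne
  -- The barycentre of s lies in no proper face of G, so the segment from v P to it extends beyond
  -- it inside G. A full-dimensional simplex t at the far end also has v P as a vertex, hence
  -- contains the barycentre and therefore s.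
  obtain ⟨r, hr, hrG⟩ := exists_add_smul_sub_mem hGconv
    (convexHull_min hsG hGconv hzs) hv fun H hH hzH =>
      hmin H ⟨hH, ⟨_, hzH⟩⟩ (hH.subset_of_average_mem hne hsG hzH)
  obtain ⟨t, ht, hrt⟩ := hK.exists_full_mem (hGP hrG)
  have hvt : v P ∈ t := h.apex_mem P (self_mem_faces h.nonempty) t ht
  obtain ⟨htK, htP⟩ := Finset.mem_filter.1 ht
  have hti := hK.indep t htK
  have hvt' : v P ∈ convexHull ℝ (t : Set E) := subset_convexHull ℝ _ hvt
  have hzt : average s ∈ convexHull ℝ (t : Set E) := by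
    have hmem := (convex_convexHull ℝ (t : Set E)).add_smul_sub_mem hvt' hrt
      (t := 1 / (1 + r)) ⟨by positivity, by rw [div_le_one (by positivity)]; linarith⟩
    convert hmem using 1
    have : (1 / (1 + r)) * (1 + r) = 1 := by field_simp
    calc average s = v P + (1 / (1 + r) * (1 + r)) • (average s - v P) := by rw [this]; module
      _ = _ := by module
  have hst := hK.subset_of_average_mem hsP htK hne hzt
  by_contra hvs
  -- If v P were not in s, the coordinate at v P would be 0 at the barycentre of s and 1 at v P,
  -- hence -r < 0 at the far end, which lies in t.
  have hb := bary_nonneg hti hrt hvt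
  have hv1 : bary t (v P) (v P) = 1 := by
    rw [bary_eq hti (w := fun y => if y = v P then 1 else 0) (by simp [hvt]) (by simp [hvt]) hvt]
    simp
  rw [show average s + r • (average s - v P) = average s + (-r) • (v P - average s) by module,
    bary_add_smul_sub hti (mem_affineSpan_of_mem_convexHull hzt)
      (mem_affineSpan_of_mem_convexHull hvt') _ hvt, bary_average hti hst hne hvt, if_neg hvs,
    hv1] at hb
  linarith

/-- The faces of `P` as a finset. -/
def faceFinset (h : IsPointed P v K) : Finset (Set E) := h.polytope.finite_faces.toFinset

theorem mem_faceFinset (h : IsPointed P v K) {F : Set E} : F ∈ h.faceFinset ↔ F ∈ faces P :=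
  Set.Finite.mem_toFinset _

theorem sum_innerPart (h : IsPointed P v K) (p : Set E → Prop) (p' : Finset E → Prop)
    [DecidablePred p] [DecidablePred p']
    (hp : ∀ F ∈ faces P, ∀ s ∈ innerPart K F, p F ↔ p' s) (N : ℕ) :
    ∑ F ∈ h.faceFinset with p F, ∑ s ∈ innerPart K F, interiorCount N s.card
      = ∑ s ∈ part K P with p' s, interiorCount N s.card := by
  rw [← Finset.sum_biUnion]
  · refine Finset.sum_subset ?_ ?_
    · intro s hs
      obtain ⟨F, hF, hs⟩ := Finset.mem_biUnion.1 hs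
      obtain ⟨hF, hpF⟩ := Finset.mem_filter.1 hF
      rw [mem_faceFinset] at hF
      have hs' := Finset.mem_filter.1 (Finset.mem_filter.1 hs).1
      exact Finset.mem_filter.2 ⟨Finset.mem_filter.2 ⟨hs'.1, hs'.2.trans (IsExposed.subset hF.1)⟩,
        (hp F hF s hs).1 hpF⟩
    · intro s hs hs'
      obtain ⟨hs, hps⟩ := Finset.mem_filter.1 hs
      rcases s.eq_empty_or_nonempty with rfl | hne
      -- The empty simplex is inner to no face, but its weight is 0.
      · rfl
      · obtain ⟨F, hF, hsF⟩ := h.exists_mem_innerPart hs hne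
        exact absurd (Finset.mem_biUnion.2 ⟨F, Finset.mem_filter.2
          ⟨h.mem_faceFinset.2 hF, (hp F hF s hsF).2 hps⟩, hsF⟩) hs'
  · intro F hF G hG hFG
    rw [Function.onFun, Finset.disjoint_left]
    intro s hsF hsG
    exact hFG (eq_of_mem_innerPart (h.mem_faceFinset.1 (Finset.mem_filter.1 hF).1)
      (h.mem_faceFinset.1 (Finset.mem_filter.1 hG).1) hsF hsG)

/-- Triangulation vertices are polytope vertices: if x is not the apex, the face to which x is inner
misses the apex. That face is therefore proper, and induction on the dimension applies. -/
theorem mem_vert [FiniteDimensional ℝ E] (h : IsPointed P v K) {x : E} (hx : {x} ∈ part K P) :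
    x ∈ vert P := by
  induction hd : dim P using Nat.strong_induction_on generalizing P with
  | _ d ih =>
    subst hd
    by_cases hxv : v P = x
    · exact hxv ▸ h.apex_mem_vert_self
    obtain ⟨F, hF, hxF⟩ := h.exists_mem_innerPart hx (Finset.singleton_nonempty x)
    have hvF : v P ∉ F := fun hv => hxv (by simpa using h.apex_mem_of_mem_innerPart hF hxF hv)
    have hFP : F ≠ P := fun he => hvF (by rw [he]; exact mem_of_mem_vert h.apex_mem_vert_self)
    have hxF' := ih _ (dim_lt_of_mem_properFaces ⟨hF, hFP⟩) (h.face hF)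
      (Finset.mem_filter.1 hxF).1 rfl
    exact h.polytope.isFace_trans hF.1 hxF'

theorem subsingleton_of_dim_eq_zero [FiniteDimensional ℝ E] {P : Set E} (h : dim P = 0) :
    P.Subsingleton := by
  rw [dim, Submodule.finrank_eq_zero] at h
  intro x hx y hy
  have := vsub_mem_vectorSpan ℝ hx hy
  rw [h] at this
  simpa [sub_eq_zero] using this

theorem sum_part_of_dim_eq_zero [FiniteDimensional ℝ E] (h : IsPointed P v K) (hd : dim P = 0)
    (N : ℕ) : ∑ s ∈ part K P, interiorCount N s.card = 1 := by
  rw [h.sum_part, Finset.sum_eq_single ∅]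
  · simp [interiorCount]
  · intro s hs hne
    obtain ⟨hs, hv⟩ := Finset.mem_filter.1 hs
    obtain ⟨x, hx⟩ := Finset.nonempty_iff_ne_empty.2 hne
    have := subsingleton_of_dim_eq_zero hd ((Finset.mem_filter.1 hs).2 hx)
      (mem_of_mem_vert h.apex_mem_vert_self)
    exact absurd (this ▸ hx) hv
  · intro hs
    exact absurd (Finset.mem_filter.2 ⟨h.empty_mem_part, by simp⟩) hs

-- Polytope numbers as total weights.

/-- Induction on the dimension handles the interior numbers of proper faces, and `sum_innerPart`
collects them into sums over simplices. The shift N + 2 skips the initial values n = 0 and n = 1. -/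
theorem polytopeNumber_eq [FiniteDimensional ℝ E] (h : IsPointed P v K) (N : ℕ) :
    polytopeNumber v P (N + 2) = ((∑ s ∈ part K P, interiorCount N s.card : ℕ) : ℤ) ∧
    interiorPolytopeNumber v P (N + 2)
      = ((∑ s ∈ innerPart K P, interiorCount N s.card : ℕ) : ℤ) := by
  induction hd : dim P using Nat.strong_induction_on generalizing P N with
  | _ d ih =>
    subst hd
    have hfin : (properFaces P).Finite := h.polytope.finite_faces.subset fun _ hF => hF.1
    have hinner : ∀ N, ∀ F ∈ properFaces P, interiorPolytopeNumber v F (N + 2)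
        = ((∑ s ∈ innerPart K F, interiorCount N s.card : ℕ) : ℤ) := fun N F hF =>
      (ih _ (dim_lt_of_mem_properFaces hF) (h.face hF.1) N rfl).2
    have hPP : P ∈ h.faceFinset := h.mem_faceFinset.2 (self_mem_faces h.nonempty)
    have hvP : v P ∈ P := mem_of_mem_vert h.apex_mem_vert_self
    have hproper : ∀ N, ∑ᶠ (F : Set E) (_ : F ∈ properFaces P), interiorPolytopeNumber v F (N + 2)
        = ((∑ s ∈ part K P, interiorCount N s.card : ℕ) : ℤ)
          - ((∑ s ∈ innerPart K P, interiorCount N s.card : ℕ) : ℤ) := by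
      intro N
      have hset : hfin.toFinset = h.faceFinset.erase P := by
        ext F
        simp [mem_faceFinset, properFaces, and_comm]
      have hsum := h.sum_innerPart (fun _ => True) (fun _ => True) (fun _ _ _ _ => Iff.rfl) N
      simp only [Finset.filter_true] at hsum
      rw [finsum_mem_eq_finite_toFinset_sum _ hfin, eq_sub_iff_add_eq, ← hsum,
        ← Finset.sum_erase_add _ _ hPP, hset, Nat.cast_add, Nat.cast_sum (h.faceFinset.erase P)]
      congr 1
      refine Finset.sum_congr rfl fun F hF => hinner N F ?_
      rw [← hset] at hF
      exact hfin.mem_toFinset.1 hF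
    have hmiss : ∀ N, ∑ᶠ (F : Set E) (_ : F ∈ properFaces P ∩ {F | v P ∉ F}),
        interiorPolytopeNumber v F (N + 2)
          = ((∑ s ∈ part K P with v P ∉ s, interiorCount N s.card : ℕ) : ℤ) := by
      intro N
      have hfin' := hfin.subset (Set.inter_subset_left (t := {F | v P ∉ F}))
      have hset : hfin'.toFinset = h.faceFinset.filter fun F => v P ∉ F := by
        ext F
        simp only [Set.Finite.mem_toFinset, Finset.mem_filter, mem_faceFinset, properFaces,
          Set.mem_inter_iff, Set.mem_ofPred_eq]
        exact ⟨fun hF => ⟨hF.1.1, hF.2⟩, fun hF => ⟨⟨hF.1, fun he => hF.2 (he ▸ hvP)⟩, hF.2⟩⟩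
      rw [← h.sum_innerPart (fun F => v P ∉ F) (fun s => v P ∉ s) (fun F hF s hs =>
          not_congr ⟨h.apex_mem_of_mem_innerPart hF hs, fun hv =>
            (Finset.mem_filter.1 (Finset.mem_filter.1 hs).1).2 hv⟩) N,
        finsum_mem_eq_finite_toFinset_sum _ hfin', hset, Nat.cast_sum]
      refine Finset.sum_congr rfl fun F hF => hinner N F ?_
      rw [← hset] at hF
      exact (hfin'.mem_toFinset.1 hF).1
    have hpoly : ∀ N, polytopeNumber v P (N + 2)
        = ((∑ s ∈ part K P, interiorCount N s.card : ℕ) : ℤ) := by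
      intro N
      by_cases hd : dim P = 0
      · rw [h.sum_part_of_dim_eq_zero hd, polytopeNumber, if_pos hd, Nat.cast_one]
      · induction N with
        | zero =>
          rw [polytopeNumber, if_neg hd, hmiss, h.sum_part_zero, polytopeNumber, Nat.cast_add,
            Nat.cast_one]
        | succ N ihN =>
          rw [polytopeNumber, if_neg hd, hmiss, h.sum_part_succ, ihN, Nat.cast_add]
    refine ⟨hpoly N, ?_⟩
    by_cases hd : dim P = 0
    · have hempty : properFaces P = ∅ := by
        refine Set.eq_empty_of_forall_notMem fun F hF => ?_
        have := dim_lt_of_mem_properFaces hF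
        omega
      have h0 := hproper N
      rw [hempty, h.sum_part_of_dim_eq_zero hd] at h0
      simp only [Set.mem_empty_iff_false, finsum_false, finsum_zero] at h0
      rw [interiorPolytopeNumber, if_pos hd]
      push_cast at h0 ⊢
      linarith
    · rw [interiorPolytopeNumber, if_neg hd, hproper, hpoly]
      ring

-- Bounding the number of visible facets, and the conclusion.

/-- Seen from a point of `P`, at least two facets of a simplex are invisible if one is visible. -/
theorem card_visible_add_two_le [FiniteDimensional ℝ E] (h : IsPointed P v K) {q : E}
    (hq : q ∈ P) {s : Finset E} (hs : s ∈ fullSimplices P (part K P))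
    (hne : (Triangulates.visible q s).Nonempty) :
    (Triangulates.visible q s).card + 2 ≤ s.card := by
  obtain ⟨hsK, hsP⟩ := Finset.mem_filter.1 hs
  have hK := h.triangulates_self
  have hsum := sum_bary (hsP hq)
  have hcomb := sum_bary_smul (hsP hq)
  have hsplit : (s.filter fun x => ¬ bary s q x < 0).card + (Triangulates.visible q s).card
      = s.card := by
    rw [add_comm]
    exact Finset.card_filter_add_card_filter_not _
  by_contra! hlt
  rcases Nat.le_one_iff_eq_zero_or_eq_one.1 (by omega :
    (s.filter fun x => ¬ bary s q x < 0).card ≤ 1) with h0 | h1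
  · have : ∑ x ∈ s, bary s q x ≤ 0 := Finset.sum_nonpos fun x hx => by
      by_contra! hpos
      have : x ∈ s.filter fun x => ¬ bary s q x < 0 :=
        Finset.mem_filter.2 ⟨hx, not_lt.2 hpos.le⟩
      rw [Finset.card_eq_zero.1 h0] at this
      simp at this
    linarith
  · obtain ⟨x, hx⟩ := Finset.card_eq_one.1 h1
    have hxs : x ∈ s := (Finset.mem_filter.1 (hx ▸ Finset.mem_singleton_self x)).1
    have hneg : ∀ y ∈ s, y ≠ x → bary s q y < 0 := fun y hy hyx => by
      by_contra hge
      have : y ∈ s.filter fun x => ¬ bary s q x < 0 := Finset.mem_filter.2 ⟨hy, hge⟩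
      rw [hx] at this
      exact hyx (Finset.mem_singleton.1 this)
    -- Suppose only the coordinate of q at x is nonnegative. A linear form with its unique maximum
    -- over P at the vertex x would then take at q a value above that maximum, since every nonzero
    -- term of `hlq` is a product of two negative numbers.
    have hxv : x ∈ vert P := h.mem_vert
      (hK.down_closed s hsK _ (Finset.singleton_subset_iff.2 hxs))
    obtain ⟨l, M, hM, hl⟩ := IsFace.exists_eq hxv (Set.singleton_nonempty x)
    have hlx : l x = M := (hl ▸ Set.mem_singleton x : x ∈ {x ∈ P | l x = M}).2
    have hly : ∀ y ∈ s, y ≠ x → l y < M := fun y hy hyx =>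
      lt_of_le_of_ne (hM y (hK.subset s hsK hy)) fun he =>
        hyx (by
          have : y ∈ ({x} : Set E) := by rw [hl]; exact ⟨hK.subset s hsK hy, he⟩
          simpa using this)
    have hlq : l q - M = ∑ y ∈ s, bary s q y * (l y - M) := by
      simp only [mul_sub, Finset.sum_sub_distrib, ← Finset.sum_mul, hsum, one_mul]
      conv_lhs => rw [← hcomb]
      simp
    obtain ⟨y, hy⟩ := hne
    obtain ⟨hys, hy0⟩ := Finset.mem_filter.1 hy
    have hyx : y ≠ x := by
      rintro rfl
      have hyf : y ∈ s.filter fun x => ¬ bary s q x < 0 := hx ▸ Finset.mem_singleton_self y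
      exact (Finset.mem_filter.1 hyf).2 hy0
    have hpos : 0 < ∑ y ∈ s, bary s q y * (l y - M) := by
      refine Finset.sum_pos' (fun z hz => ?_) ⟨y, hys, ?_⟩
      · by_cases hzx : z = x
        · simp [hzx, hlx]
        · exact mul_nonneg_of_nonpos_of_nonpos (hneg z hz hzx).le
            (sub_nonpos.2 (hly z hz hzx).le)
      · exact mul_pos_of_neg_of_neg hy0 (sub_neg.2 (hly y hys hyx))
    linarith [hM q hq]

end IsPointed

theorem simplexNumber_sub_eq_choose {d i : ℕ} (hi : i ≤ d) (N : ℕ) :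
    simplexNumber d (((N + 2 : ℕ) : ℤ) - i) = (N + (d + 1 - i)).choose d := by
  rw [simplexNumber]
  -- Here N + 2 ≤ i, so the upper index on the right is below d; this uses i ≤ d, which keeps the
  -- subtraction from truncating.
  split_ifs with h
  · exact (Nat.choose_eq_zero_of_lt (by omega)).symm
  · congr 1
    omega

theorem simplexNumber_of_nonpos {d : ℕ} {m : ℤ} (hm : m ≤ 0) : simplexNumber d m = 0 := if_pos hm

end

end PolytopeNumbers

open PolytopeNumbers

theorem mainTheorem1 {e d : ℕ} (P : Set (EuclideanSpace ℝ (Fin e)))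
    (hP : PolytopeNumbers.IsDPolytope d P)
    (C : Set (Set (EuclideanSpace ℝ (Fin e))))
    (v : Set (EuclideanSpace ℝ (Fin e)) → EuclideanSpace ℝ (Fin e))
    (hC : PolytopeNumbers.IsPointedTriangulation P v C) :
    ∃ a : ℕ → ℕ, ∀ n : ℕ,
      PolytopeNumbers.polytopeNumber v P n =
        (PolytopeNumbers.simplexNumber d n : ℤ) +
          ∑ i ∈ Finset.Icc 1 (d - 1),
            (a i : ℤ) * (PolytopeNumbers.simplexNumber d ((n : ℤ) - (i : ℤ)) : ℤ) := by
  classical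
  obtain ⟨hpoly, hne, hdim⟩ := hP
  have h := hC.isPointed hpoly hne
  set K := (finite_vertexSets hC.triangulation.complex.finite).toFinset
  have hK := h.triangulates_self
  obtain ⟨q, hq⟩ := hK.exists_isGeneric
  have hzero : ∀ n : ℕ, n ≤ 1 → ∀ f : ℕ → ℕ, ∑ i ∈ Finset.Icc 1 (d - 1),
      (f i : ℤ) * (simplexNumber d ((n : ℤ) - (i : ℤ)) : ℤ) = 0 := fun n hn f =>
    Finset.sum_eq_zero fun i hi => by
      have := (Finset.mem_Icc.1 hi).1
      rw [simplexNumber_of_nonpos (by omega), Nat.cast_zero, mul_zero]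
  -- The coefficient a_i is the number of full-dimensional simplices with exactly i facets visible
  -- from q.
  refine ⟨fun i => ((fullSimplices P (part K P)).filter
    fun s => (Triangulates.visible q s).card = i).card, fun n => ?_⟩
  match n with
  | 0 =>
    rw [hzero 0 (by omega), polytopeNumber, simplexNumber_of_nonpos (by simp)]
    simp
  | 1 =>
    rw [hzero 1 le_rfl, polytopeNumber]
    simp [simplexNumber]
  | N + 2 =>
    have hvis : ∀ s ∈ fullSimplices P (part K P),
        (Triangulates.visible q s).card ∈ insert 0 (Finset.Icc 1 (d - 1)) := by
      intro s hs
      rw [Finset.mem_insert, Finset.mem_Icc]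
      rcases (Triangulates.visible q s).eq_empty_or_nonempty with h0 | h0
      · exact Or.inl (by rw [h0, Finset.card_empty])
      · have h1 := h.card_visible_add_two_le hq.1 hs h0
        rw [hK.card_of_mem_fullSimplices hs, hdim] at h1
        have := Finset.card_pos.2 h0
        omega
    have hterm : ∀ s ∈ fullSimplices P (part K P),
        interiorCount (N + (s.card - (Triangulates.visible q s).card)) s.card
          = simplexNumber d (((N + 2 : ℕ) : ℤ) - ((Triangulates.visible q s).card : ℕ)) := by
      intro s hs
      have h1 := hvis s hs
      rw [Finset.mem_insert, Finset.mem_Icc] at h1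
      rw [simplexNumber_sub_eq_choose (by omega), hK.card_of_mem_fullSimplices hs, hdim]
      rfl
    rw [(h.polytopeNumber_eq N).1, hK.sum_interiorCount hq, Finset.sum_congr rfl hterm,
      ← Finset.sum_fiberwise_of_maps_to hvis, Finset.sum_insert (by simp)]
    have hfib : ∀ i, ∑ s ∈ fullSimplices P (part K P) with (Triangulates.visible q s).card = i,
        simplexNumber d (((N + 2 : ℕ) : ℤ) - ((Triangulates.visible q s).card : ℕ))
          = ((fullSimplices P (part K P)).filter
              fun s => (Triangulates.visible q s).card = i).card
            * simplexNumber d (((N + 2 : ℕ) : ℤ) - (i : ℕ)) := by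
      intro i
      rw [Finset.sum_congr rfl (g := fun _ => simplexNumber d (((N + 2 : ℕ) : ℤ) - (i : ℕ)))
        fun s hs => by rw [(Finset.mem_filter.1 hs).2], Finset.sum_const, smul_eq_mul]
    simp only [hfib]
    rw [hK.card_filter_visible_eq_empty hq]
    push_cast
    simp
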